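/- Let $H\in(1/2,1)$ and let $B_H=(B_H(t))_{t\in[0,1]}$ be a fractional Brownian motion over $[0,1]$ with Hurst index $H$ on a probability space $(\Omega,\mathcal A,\mathbb P)$, i.e. a centred Gaussian process with $\mathrm{Cov}(B_H(t),B_H(s))=\frac12\left(|t|^{2H}+|s|^{2H}-|t-s|^{2H}\right)$. **Definitions.** A *random measure* over $[0,1]$ is a $\sigma$-additive map $M:\mathcal B([0,1])\to L^2(\Omega,\mathcal A,\mathbb P)$ for which there is a real (signed) measure $C_M$ on $[0,1]^2$ with $C_M(A\times B)=\mathrm{Cov}(M(A),M(B))$ for all Borel $A,B$. A *Riemann system* of a Borel set $D\subset[0,1]$ is a sequence, indexed by $n\in\mathbb N$, of finite Borel partitions $(I^n_j)_{j\in J_n}$ of $D$ (empty parts allowed) with $|J_n|\nearrow\infty$ and $\max_j\mathrm{diam}(I_j^n)\to0$, together with tag points $x^n_j\in[0,1]$, where $x_j^n\in I^n_j$ whenever $I^n_j\neq\emptyset$. A *continuous-function-measure kernel* over a compact space $E$ is a map $K$ such that $K(x,\cdot)$ is a real measure on $E$ for every $x\in E$ and $K(\cdot,A)$ is continuous on $E$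 for every Borel $A$. A kernel $K$ over $[0,1]$ is *self-integrable* over $D$ if there is a unique $\ell\in\mathbb R$ such that $\sum_{j}K(x_j^n,I_j^n)\to\ell$ for every Riemann system of $D$; then $\int_DK(x,dx):=\ell$. Its *second-order kernel* is $K^{(2)}((x,y),\cdot)=K(y,\cdot)\otimes K(x,\cdot)$, and $K^{(2)}$ is *quasi-self-integrable* over $A\times B$ with quasi-self-integral $\ell$ if $\ell$ is the unique real number such that $\lim_{(n,m)\to\infty}\sum_j\sum_kK^{(2)}((a^n_j,b^m_k),A^n_j\times B^m_k)=\ell$ for all Riemann systems $(A^n_j,a^n_j)$ of $A$ and $(B^m_k,b^m_k)$ of $B$. The stochastic integral $\int_DZ\,dM$ of a process $Z$ is *uniquely defined* in $L^2$ if there is a unique $Y\in L^2(\Omega,\mathcal A,\mathbb P)$ with $\sum_jZ(x_j^n)M(I_j^n)\to Y$ in $L^2$ for every Riemann system of $D$; then $\int_DZ\,dM:=Y$. **Statement.** 1. There is a unique random measure $B_H'$ over $[0,1]$ with $B_H'(\{0\})=B_H'(\{1\})=0$ that is the distributional derivative of $B_H$ on $(0,1)$, i.e. $\int_{[0,1]}\varphi\,dB_H'=-\int_0^1\varphi'(t)B_H(t)\,dt$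 for all $\varphi\in C_c^\infty((0,1))$. (The left side is the stochastic integral of the deterministic process $\varphi$, uniquely defined in $L^2$.) It is centred, satisfies $B_H'([0,t])=B_H(t)$ a.s. for every $t\in[0,1]$, and its covariance measure is $C_{B_H'}(E)=H(2H-1)\int_E|u-v|^{2H-2}\,d(u,v)$ for every Borel $E\subset[0,1]^2$, the density being integrable. 2. The kernel $K(t,A)=\mathrm{Cov}(B_H(t),B_H'(A))$ is a non-negative continuous-function-measure kernel over $[0,1]$, given by $K(t,A)=H\int_A\left(u^{2H-1}+|t-u|^{2H-1}\mathrm{sgn}(t-u)\right)du$, and $K^{(2)}$ is a continuous-function-measure kernel over $[0,1]^2$. 3. $K$ is self-integrable over $[0,1]$ with $\int_{[0,1]}K(x,dx)=\frac12$. 4. $K^{(2)}$ is quasi-self-integrable over $[0,1]\times[0,1]$, with quasi-self-integral $$\frac12-H\,\mathbf B(2H,2H+1)-\frac{H}{2(4H-1)},$$ where $\mathbf B$ is the beta function. 5. For every Borel set $A\subset[0,1]$ the stochastic integral $\int_AB_H\,dB_H'$ is uniquely defined in $L^2$, and $A\mapsto\int_AB_H\,dB_H'$ is a random measure over $[0,1]$.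 -/

import Mathlib

open MeasureTheory ProbabilityTheory Filter Topology
open scoped ENNReal

namespace SelfIntegral

/-- A Riemann system of a set `D`: for every `n` a finite Borel partition `(part n j)_j` of `D` with
tag points, such that the number of parts increases to infinity and the mesh tends to `0`.
Parts may be empty (so that finite sets have Riemann systems as well); the tag of a nonempty part
lies in that part. -/
structure RiemannSystem {X : Type*} [PseudoEMetricSpace X] [MeasurableSpace X] (D : Set X) where
  card : ℕ → ℕ
  part : (n : ℕ) → Fin (card n) → Set X
  tag : (n : ℕ) → Fin (card n) → X
  card_mono : Monotone card
  card_tendsto : Tendsto card atTop atTop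
  measurableSet_part : ∀ n j, MeasurableSet (part n j)
  disjoint_part : ∀ n, Pairwise fun i j => Disjoint (part n i) (part n j)
  iUnion_part : ∀ n, ⋃ j, part n j = D
  mesh_tendsto : Tendsto (fun n => ⨆ j, Metric.ediam (part n j)) atTop (𝓝 0)
  tag_mem : ∀ n j, (part n j).Nonempty → tag n j ∈ part n j

section Kernels

/-- `K` is a continuous-function-measure kernel: `K x` is a real measure for every `x`, and
`x ↦ K x A` is continuous for every Borel set `A`.  (The spaces used here are compact, so that
every Borel set is bounded and a real measure is a signed measure.) -/
def IsCfmKernel {X Y : Type*} [TopologicalSpace X] [MeasurableSpace Y]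
    (K : X → SignedMeasure Y) : Prop :=
  ∀ A, MeasurableSet A → Continuous fun x => K x A

variable {X : Type*} [PseudoEMetricSpace X] [MeasurableSpace X]

/-- `ℓ` is the limit of the Riemann sums `∑ⱼ K (xⱼ, Iⱼ)` along every Riemann system of `D`. -/
def IsSelfIntegral (K : X → SignedMeasure X) (D : Set X) (ℓ : ℝ) : Prop :=
  ∀ R : RiemannSystem D,
    Tendsto (fun n => ∑ j, K (R.tag n j) (R.part n j)) atTop (𝓝 ℓ)

/-- `K` is self-integrable over `D`. -/
def SelfIntegrable (K : X → SignedMeasure X) (D : Set X) : Prop :=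
  ∃! ℓ : ℝ, IsSelfIntegral K D ℓ

/-- The second-order kernel `K⁽²⁾ ((x, y), ·) = K (y, ·) ⊗ K (x, ·)`. -/
noncomputable def secondOrderKernel {X Y : Type*} [MeasurableSpace Y] (K : X → SignedMeasure Y) :
    X × X → SignedMeasure (Y × Y) :=
  fun p => VectorMeasure.prod (K p.2) (K p.1) (ContinuousLinearMap.mul ℝ ℝ)

theorem secondOrderKernel_prod {X Y : Type*} [MeasurableSpace Y] (K : X → SignedMeasure Y)
    (x y : X) (A B : Set Y) : secondOrderKernel K (x, y) (A ×ˢ B) = K y A * K x B := by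
  have : IsFiniteMeasure (K y).variation := by
    rw [← SignedMeasure.totalVariation_eq_variation]
    unfold SignedMeasure.totalVariation
    infer_instance
  simp only [secondOrderKernel]
  rw [VectorMeasure.prod_apply]
  rfl

/-- `ℓ` is the double limit, as `(n, m) → ∞`, of `∑ⱼ ∑ₖ L ((aⱼ, bₖ), Aⱼ × Bₖ)` along every Riemann
system of `A` and every Riemann system of `B`. -/
def IsQuasiSelfIntegral (L : X × X → SignedMeasure (X × X)) (A B : Set X) (ℓ : ℝ) : Prop :=
  ∀ (R : RiemannSystem A) (S : RiemannSystem B),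
    Tendsto (fun q : ℕ × ℕ => ∑ j, ∑ k,
        L (R.tag q.1 j, S.tag q.2 k) (R.part q.1 j ×ˢ S.part q.2 k))
      (atTop ×ˢ atTop) (𝓝 ℓ)

/-- `L` is quasi-self-integrable over `A × B`. -/
def QuasiSelfIntegrable (L : X × X → SignedMeasure (X × X)) (A B : Set X) : Prop :=
  ∃! ℓ : ℝ, IsQuasiSelfIntegral L A B ℓ

end Kernels

section Probability

variable {Ω : Type*} [MeasurableSpace Ω]

/-- `C` is the covariance measure of the `L²(P)`-valued measure `M`. -/
def IsCovarianceMeasure {X : Type*} [MeasurableSpace X] (P : Measure Ω)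
    (M : VectorMeasure X (Lp ℝ 2 P)) (C : SignedMeasure (X × X)) : Prop :=
  ∀ A B, MeasurableSet A → MeasurableSet B → C (A ×ˢ B) = cov[M A, M B; P]

/-- A random measure: a σ-additive `L²(P)`-valued set function whose covariance structure is given
by a real measure on the product space. -/
def IsRandomMeasure {X : Type*} [MeasurableSpace X] (P : Measure Ω)
    (M : VectorMeasure X (Lp ℝ 2 P)) : Prop :=
  ∃ C : SignedMeasure (X × X), IsCovarianceMeasure P M C

theorem cov_eq_inner {P : Measure Ω} [IsProbabilityMeasure P] {Z : Ω → ℝ} (hZ : MemLp Z 2 P)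
    (Y : Lp ℝ 2 P) :
    cov[Z, Y; P] = inner ℝ ((hZ.sub (memLp_const (∫ ω, Z ω ∂P))).toLp _) Y := by
  have hY : MemLp Y 2 P := Lp.memLp Y
  rw [L2.inner_def, covariance_eq_sub hZ hY]
  have h1 : (fun ω => inner ℝ
      (((hZ.sub (memLp_const (∫ ω, Z ω ∂P))).toLp _ : Lp ℝ 2 P) ω) (Y ω))
      =ᵐ[P] fun ω => (Z * Y) ω - (∫ ω, Z ω ∂P) * Y ω := by
    filter_upwards [(hZ.sub (memLp_const (∫ ω, Z ω ∂P))).coeFn_toLp] with ω hω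
    rw [hω]
    simp [sub_mul, mul_comm]
  rw [integral_congr_ae h1, integral_sub (hZ.integrable_mul hY)
    ((hY.integrable (by norm_num)).const_mul _), integral_const_mul]

/-- The map `Y ↦ Cov(Z, Y)` on `L²(P)`. -/
noncomputable def covHom (P : Measure Ω) [IsProbabilityMeasure P] (Z : Ω → ℝ)
    (hZ : MemLp Z 2 P) : Lp ℝ 2 P →+ ℝ where
  toFun Y := cov[Z, Y; P]
  map_zero' := by rw [cov_eq_inner hZ, inner_zero_right]
  map_add' Y Y' := by simp only [cov_eq_inner hZ, inner_add_right]

theorem continuous_covHom (P : Measure Ω) [IsProbabilityMeasure P] (Z : Ω → ℝ)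
    (hZ : MemLp Z 2 P) : Continuous (covHom P Z hZ) := by
  have h : ⇑(covHom P Z hZ) =
      fun Y : Lp ℝ 2 P => inner ℝ ((hZ.sub (memLp_const (∫ ω, Z ω ∂P))).toLp _) Y :=
    funext fun Y => cov_eq_inner hZ Y
  rw [h]
  fun_prop

/-- The cross-covariance kernel `K (x, A) = Cov(Z x, M A)` of a second-order process `Z` and an
`L²(P)`-valued measure `M`. -/
noncomputable def crossCovKernel {X Y : Type*} [MeasurableSpace Y] (P : Measure Ω)
    [IsProbabilityMeasure P] (Z : X → Ω → ℝ) (hZ : ∀ x, MemLp (Z x) 2 P)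
    (M : VectorMeasure Y (Lp ℝ 2 P)) : X → SignedMeasure Y :=
  fun x => M.mapRange (covHom P (Z x) (hZ x)) (continuous_covHom P (Z x) (hZ x))

theorem crossCovKernel_apply {X Y : Type*} [MeasurableSpace Y] (P : Measure Ω)
    [IsProbabilityMeasure P] (Z : X → Ω → ℝ) (hZ : ∀ x, MemLp (Z x) 2 P)
    (M : VectorMeasure Y (Lp ℝ 2 P)) (x : X) (A : Set Y) :
    crossCovKernel P Z hZ M x A = cov[Z x, M A; P] := rfl

/-- The random variable `Y` is the limit in `L^p(P)` of the Riemann sums `∑ⱼ Z (xⱼ) M (Iⱼ)` along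
every Riemann system of `D`. -/
def IsStochIntegral {X : Type*} [PseudoEMetricSpace X] [MeasurableSpace X] (p : ℝ≥0∞)
    (P : Measure Ω) (Z : X → Ω → ℝ) (M : VectorMeasure X (Lp ℝ 2 P)) (D : Set X)
    (Y : Lp ℝ p P) : Prop :=
  ∀ R : RiemannSystem D,
    Tendsto (fun n => eLpNorm
      (fun ω => (∑ j, Z (R.tag n j) ω * (M (R.part n j) : Ω → ℝ) ω) - Y ω) p P) atTop (𝓝 0)

/-- The stochastic integral `∫_D Z dM` is uniquely defined in the sense of `L^p(P)`. -/
def StochIntegralUniquelyDefined {X : Type*} [PseudoEMetricSpace X] [MeasurableSpace X] (p : ℝ≥0∞)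
    (P : Measure Ω) (Z : X → Ω → ℝ) (M : VectorMeasure X (Lp ℝ 2 P)) (D : Set X) : Prop :=
  ∃! Y : Lp ℝ p P, IsStochIntegral p P Z M D Y

/-- `B` is a fractional Brownian motion over `[0,1]` with Hurst index `H`. -/
structure IsFractionalBrownianMotion (H : ℝ) (B : unitInterval → Ω → ℝ) (P : Measure Ω) :
    Prop where
  isGaussianProcess : IsGaussianProcess B P
  centred : ∀ t, ∫ ω, B t ω ∂P = 0
  cov_eq : ∀ t s, cov[B t, B s; P] =
    (|(t : ℝ)| ^ (2 * H) + |(s : ℝ)| ^ (2 * H) - |(t : ℝ) - s| ^ (2 * H)) / 2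

theorem IsFractionalBrownianMotion.memLp {H : ℝ} {B : unitInterval → Ω → ℝ} {P : Measure Ω}
    (hB : IsFractionalBrownianMotion H B P) (t : unitInterval) : MemLp (B t) 2 P :=
  (hB.isGaussianProcess.hasGaussianLaw_eval t).memLp_two

/-- On the open interval `(0,1)`, the `L²(P)`-valued measure `M` is the distributional derivative of
the second-order process `Z`: `∫ φ dM = - ∫ φ'(t) Z(t) dt` for all smooth `φ` with compact support
in `(0,1)`.  The left side is the integral of a deterministic continuous function, the right side
a Bochner integral in `L²(P)`. -/
def IsDistributionalDerivative (P : Measure Ω) (Z : unitInterval → Ω → ℝ)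
    (hZ : ∀ t, MemLp (Z t) 2 P) (M : VectorMeasure unitInterval (Lp ℝ 2 P)) : Prop :=
  ∀ φ : ℝ → ℝ, ContDiff ℝ ((⊤ : ℕ∞) : WithTop ℕ∞) φ → HasCompactSupport φ →
    tsupport φ ⊆ Set.Ioo 0 1 →
    IsStochIntegral 2 P (fun (t : unitInterval) _ => φ t) M Set.univ
      (-∫ t : unitInterval, deriv φ t • (hZ t).toLp (Z t))

/-- `M` is the derivative random measure of `Z` over `[0,1]`: a random measure which is the
distributional derivative of `Z` on `(0,1)` and does not charge the two endpoints. -/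
structure IsDerivativeRandomMeasure (P : Measure Ω) (Z : unitInterval → Ω → ℝ)
    (hZ : ∀ t, MemLp (Z t) 2 P) (M : VectorMeasure unitInterval (Lp ℝ 2 P)) : Prop where
  isRandomMeasure : IsRandomMeasure P M
  isDistributionalDerivative : IsDistributionalDerivative P Z hZ M
  zero_endpoint : M {0} = 0
  one_endpoint : M {1} = 0

end Probability

end SelfIntegral

/-!
A vector measure is pinned down by its values on the intervals `[0,t]`. For `B_H'` these are the
vectors `B_H(t)`, whose inner products are `γ([0,s] × [0,t])` for the finite measure `γ` with
density `H(2H-1)|u-v|^(2H-2)`. By the Schur test, `f ↦ ∫ f dB_H'`, given on step functions, extends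
continuously from `L²(μ)`, where `μ` is the sum of the two marginals of `γ`; its values on
indicators are the measure.

The kernel `K(t,·) = Cov(B_H(t), B_H'(·))` has a continuous density `κ(t,·)`. By uniform continuity
the Riemann sums of such a kernel converge to `∫ κ(u,u) du`, and those of `K^(2)` to the integral
of `κ(v,u) κ(u,v)`. Both are elementary, apart from one beta integral.

For Gaussian variables the Isserlis formula writes the inner product of two Riemann sums of
`∫_A B_H dB_H'` as the sum of a product of Riemann sums of `K`, a double Riemann sum of `K^(2)` and
a double Riemann sum of the covariance function of `B_H` against `γ`. All three converge, hence so
do the stochastic sums in `L²`. The limit of the inner products of the integrals over `A` and over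
`A'` is the value on `A × A'` of a finite signed measure, so the integral is σ-additive in `A` and
has a covariance measure.
-/

namespace SelfIntegral

theorem isFiniteMeasure_variation {X : Type*} [MeasurableSpace X] (ν : SignedMeasure X) :
    IsFiniteMeasure ν.variation := by
  rw [← SignedMeasure.totalVariation_eq_variation]
  unfold SignedMeasure.totalVariation
  infer_instance

/-- The inner products of the values of the Hilbert space valued set function `N` are given by the
real measure `C` on the product space: the abstract form of "`N` has covariance measure `C`". -/
def HasGramMeasure {X E : Type*} [MeasurableSpace X] [NormedAddCommGroup E]
    [InnerProductSpace ℝ E] (N : Set X → E) (C : SignedMeasure (X × X)) : Prop :=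
  ∀ A B, MeasurableSet A → MeasurableSet B → inner ℝ (N A) (N B) = C (A ×ˢ B)

namespace HasGramMeasure

variable {X E : Type*} [MeasurableSpace X] [NormedAddCommGroup E] [InnerProductSpace ℝ E]
  {N : Set X → E} {C : SignedMeasure (X × X)}

theorem apply_empty (h : HasGramMeasure N C) : N ∅ = 0 := by
  rw [← inner_self_eq_zero (𝕜 := ℝ), h _ _ .empty .empty, Set.empty_prod, C.empty]

theorem apply_union (h : HasGramMeasure N C) {A B : Set X} (hA : MeasurableSet A)
    (hB : MeasurableSet B) (hAB : Disjoint A B) : N (A ∪ B) = N A + N B := by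
  have hU := hA.union hB
  have hl (D) (hD : MeasurableSet D) : C ((A ∪ B) ×ˢ D) = C (A ×ˢ D) + C (B ×ˢ D) := by
    rw [Set.union_prod, C.of_union (Set.disjoint_prod.2 (Or.inl hAB)) (hA.prod hD) (hB.prod hD)]
  have hr (D) (hD : MeasurableSet D) : C (D ×ˢ (A ∪ B)) = C (D ×ˢ A) + C (D ×ˢ B) := by
    rw [Set.prod_union, C.of_union (Set.disjoint_prod.2 (Or.inr hAB)) (hD.prod hA) (hD.prod hB)]
  rw [← sub_eq_zero, ← inner_self_eq_zero (𝕜 := ℝ)]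
  simp only [inner_sub_left, inner_sub_right, inner_add_left, inner_add_right]
  rw [h _ _ hU hU, h _ _ hU hA, h _ _ hU hB, h _ _ hA hU, h _ _ hB hU, h _ _ hA hA,
    h _ _ hA hB, h _ _ hB hA, h _ _ hB hB, hl _ hU, hr _ hA, hr _ hB, hl _ hA, hl _ hB]
  ring

theorem apply_biUnion_finset (h : HasGramMeasure N C) {ι : Type*} {f : ι → Set X}
    (hf : ∀ i, MeasurableSet (f i)) (hd : Pairwise (Function.onFun Disjoint f)) (s : Finset ι) :
    N (⋃ i ∈ s, f i) = ∑ i ∈ s, N (f i) := by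
  classical
  induction s using Finset.induction_on with
  | empty => simp [h.apply_empty]
  | insert a s ha ih =>
    have hdisj : Disjoint (f a) (⋃ i ∈ s, f i) :=
      Set.disjoint_iUnion₂_right.2 fun i hi => hd fun hai => ha (hai ▸ hi)
    rw [Finset.set_biUnion_insert, Finset.sum_insert ha,
      h.apply_union (hf a) (Finset.measurableSet_biUnion _ fun i _ => hf i) hdisj, ih]

theorem norm_sq_le (h : HasGramMeasure N C) {A : Set X} (hA : MeasurableSet A) :
    ‖N A‖ ^ 2 ≤ C.variation.fst.real A := by
  have := isFiniteMeasure_variation C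
  calc ‖N A‖ ^ 2 = C (A ×ˢ A) := by rw [← real_inner_self_eq_norm_sq, h _ _ hA hA]
    _ ≤ C.variation.real (A ×ˢ A) :=
        (Real.le_norm_self _).trans VectorMeasure.norm_measure_le_variation
    _ ≤ C.variation.real (Prod.fst ⁻¹' A) := measureReal_mono fun x hx => hx.1
    _ = C.variation.fst.real A := (map_measureReal_apply measurable_fst hA).symm

theorem hasSum (h : HasGramMeasure N C) {f : ℕ → Set X} (hf : ∀ i, MeasurableSet (f i))
    (hd : Pairwise (Function.onFun Disjoint f)) : HasSum (fun i => N (f i)) (N (⋃ i, f i)) := by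
  have := isFiniteMeasure_variation C
  set ρ := C.variation.fst
  set U := ⋃ i, f i
  have hU : MeasurableSet U := .iUnion hf
  have hsub (s : Finset ℕ) : ⋃ i ∈ s, f i ⊆ U := Set.iUnion₂_subset fun i _ => Set.subset_iUnion f i
  have hm (s : Finset ℕ) : MeasurableSet (⋃ i ∈ s, f i) :=
    Finset.measurableSet_biUnion _ fun i _ => hf i
  have hbound (s : Finset ℕ) : ‖∑ i ∈ s, N (f i) - N U‖ ^ 2 ≤ ρ.real U - ∑ i ∈ s, ρ.real (f i) := by
    have hrest := h.apply_union (hm s) (hU.diff (hm s)) Set.disjoint_sdiff_right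
    rw [Set.union_sdiff_cancel (hsub s), h.apply_biUnion_finset hf hd] at hrest
    rw [hrest, sub_add_cancel_left, norm_neg,
      ← measureReal_biUnion_finset (fun i _ j _ hij => hd hij) (fun i _ => hf i),
      ← measureReal_sdiff (hsub s) (hm s)]
    exact h.norm_sq_le (hU.diff (hm s))
  have hsum : HasSum (fun i => ρ.real (f i)) (ρ.real U) := by
    simpa [Measure.toSignedMeasure_apply, hf, MeasurableSet.iUnion hf] using
      ρ.toSignedMeasure.m_iUnion hf hd
  have hsq : Tendsto (fun s : Finset ℕ => ‖∑ i ∈ s, N (f i) - N U‖ ^ 2) atTop (𝓝 0) := by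
    refine squeeze_zero (fun s => by positivity) hbound ?_
    rw [← sub_self (ρ.real U)]
    exact Tendsto.const_sub _ hsum
  exact tendsto_iff_norm_sub_tendsto_zero.2 (by simpa using hsq.sqrt)

theorem exists_vectorMeasure (h : HasGramMeasure N C) :
    ∃ V : VectorMeasure X E, ∀ A, MeasurableSet A → V A = N A := by
  classical
  refine ⟨⟨fun A => if MeasurableSet A then N A else 0, by simp [h.apply_empty],
    fun A hA => by simp [hA], fun f hf hd => ?_⟩, fun A hA => by simp [hA]⟩
  simpa only [hf, MeasurableSet.iUnion hf, if_true] using h.hasSum hf hd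

end HasGramMeasure

theorem vectorMeasure_ext_Iic {X E : Type*} [TopologicalSpace X] [LinearOrder X] [OrderTopology X]
    [SecondCountableTopology X] [OrderTop X] [MeasurableSpace X] [BorelSpace X] [AddCommGroup E]
    [TopologicalSpace E] [T2Space E] [IsTopologicalAddGroup E] {μ ν : VectorMeasure X E}
    (h : ∀ t, μ (Set.Iic t) = ν (Set.Iic t)) : μ = ν := by
  refine VectorMeasure.ext_of_generateFrom (Set.range Set.Iic) ?_ ?_ isPiSystem_Iic ?_
  · rintro _ ⟨t, rfl⟩
    exact h t
  · rw [← borel_eq_generateFrom_Iic]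
    exact BorelSpace.measurable_eq
  · rw [← Set.Iic_top, h]

section RiemannSums

theorem tendsto_sum_setIntegral_tag {Y ι E F G : Type*} [PseudoMetricSpace Y] [CompactSpace Y]
    [MeasurableSpace Y] [BorelSpace Y] [NormedAddCommGroup E] [NormedSpace ℝ E]
    [NormedAddCommGroup F] [NormedSpace ℝ F] [NormedAddCommGroup G] [NormedSpace ℝ G]
    {l : Filter ι} {J : ι → Type*} [∀ i, Fintype (J i)] {S : ∀ i, J i → Set Y} {t : ∀ i, J i → Y}
    {D : Set Y} (hS : ∀ i j, MeasurableSet (S i j))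
    (hd : ∀ i, Pairwise fun j k => Disjoint (S i j) (S i k)) (hU : ∀ i, ⋃ j, S i j = D)
    (hmesh : ∀ δ > 0, ∀ᶠ i in l, ∀ j, ∀ y ∈ S i j, dist y (t i j) < δ)
    (ν : VectorMeasure Y F) [IsFiniteMeasure ν.variation] (B : E →L[ℝ] F →L[ℝ] G)
    {g : Y × Y → E} (hg : Continuous g) :
    Tendsto (fun i => ∑ j, ∫ᵛ y in S i j, g (t i j, y) ∂[B; ν]) l
      (𝓝 (∫ᵛ y in D, g (y, y) ∂[B; ν])) := by
  have hint (f : Y → E) (hf : Continuous f) : ν.Integrable f :=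
    hf.integrable_of_hasCompactSupport (HasCompactSupport.of_compactSpace f)
  have hg_tag (s) : Continuous fun y => g (s, y) := hg.comp (by fun_prop)
  have hg_diag : Continuous fun y => g (y, y) := hg.comp (by fun_prop)
  rw [Metric.tendsto_nhds]
  intro ε hε
  set v := ‖B‖ * ν.variation.real D
  have : 0 ≤ v := by positivity
  obtain ⟨δ, hδ, hgδ⟩ := Metric.uniformContinuous_iff.1
    (CompactSpace.uniformContinuous_of_continuous hg) (ε / (v + 1)) (by positivity)
  filter_upwards [hmesh δ hδ] with i hi
  have hpart (j) : ‖∫ᵛ y in S i j, g (t i j, y) ∂[B; ν] -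
      ∫ᵛ y in S i j, g (y, y) ∂[B; ν]‖ ≤
        ε / (v + 1) * ‖B‖ * ν.variation.real (S i j) := by
    rw [← VectorMeasure.integral_fun_sub (hint _ (hg_tag _)).integrableOn
      (hint _ hg_diag).integrableOn]
    refine VectorMeasure.norm_setIntegral_le_of_norm_le_const fun y hy => ?_
    rw [← dist_eq_norm]
    exact (hgδ (by rw [Prod.dist_eq, dist_comm]; simpa [hδ] using hi j y hy)).le
  have hvar : ∑ j, ν.variation.real (S i j) = ν.variation.real D := by
    rw [← hU i, measureReal_iUnion_fintype (hd i) (hS i)]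
  rw [← hU i, VectorMeasure.setIntegral_iUnion_fintype (hS i) (hd i)
    fun j => (hint _ hg_diag).integrableOn, dist_eq_norm, ← Finset.sum_sub_distrib]
  calc ‖∑ j, _‖ ≤ ∑ j, ε / (v + 1) * ‖B‖ * ν.variation.real (S i j) :=
        norm_sum_le_of_le _ fun j _ => hpart j
    _ = ε * (v / (v + 1)) := by rw [← Finset.mul_sum, hvar]; ring
    _ < ε := mul_lt_of_lt_one_right hε ((div_lt_one (by positivity)).2 (lt_add_one v))

namespace RiemannSystem

variable {X : Type*} [PseudoMetricSpace X] [MeasurableSpace X] {D : Set X}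

theorem eventually_dist_lt (R : RiemannSystem D) {δ : ℝ} (hδ : 0 < δ) :
    ∀ᶠ n in atTop, ∀ j, ∀ y ∈ R.part n j, dist y (R.tag n j) < δ := by
  filter_upwards [R.mesh_tendsto.eventually_lt_const (ENNReal.ofReal_pos.2 hδ)] with n hn j y hy
  rw [← ENNReal.ofReal_lt_ofReal_iff hδ, ← edist_dist]
  calc edist y (R.tag n j) ≤ Metric.ediam (R.part n j) :=
        Metric.edist_le_ediam_of_mem hy (R.tag_mem n j ⟨y, hy⟩)
    _ ≤ ⨆ j, Metric.ediam (R.part n j) := le_iSup (fun j => Metric.ediam (R.part n j)) j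
    _ < ENNReal.ofReal δ := hn

variable [CompactSpace X] [BorelSpace X]

theorem tendsto_sum_setIntegral (R : RiemannSystem D) (ρ : Measure X) [IsFiniteMeasure ρ]
    {g : X × X → ℝ} (hg : Continuous g) :
    Tendsto (fun n => ∑ j, ∫ y in R.part n j, g (R.tag n j, y) ∂ρ) atTop
      (𝓝 (∫ y in D, g (y, y) ∂ρ)) := by
  have hD : MeasurableSet D := R.iUnion_part 0 ▸ .iUnion (R.measurableSet_part 0)
  have := isFiniteMeasure_variation ρ.toSignedMeasure
  simpa only [VectorMeasure.setIntegral_toSignedMeasure, hD, R.measurableSet_part] using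
    tendsto_sum_setIntegral_tag R.measurableSet_part R.disjoint_part R.iUnion_part
      (fun _ => R.eventually_dist_lt) ρ.toSignedMeasure (ContinuousLinearMap.lsmul ℝ ℝ).flip hg

theorem tendsto_sum_mul_signedMeasure (R : RiemannSystem D) (ν : SignedMeasure X) {f : X → ℝ}
    (hf : Continuous f) :
    Tendsto (fun n => ∑ j, f (R.tag n j) * ν (R.part n j)) atTop
      (𝓝 (∫ᵛ y in D, f y ∂<•ν)) := by
  have := isFiniteMeasure_variation ν
  simpa only [VectorMeasure.setIntegral_const, ContinuousLinearMap.flip_apply,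
    ContinuousLinearMap.lsmul_apply, smul_eq_mul, mul_comm] using
    tendsto_sum_setIntegral_tag R.measurableSet_part R.disjoint_part R.iUnion_part
      (fun _ => R.eventually_dist_lt) ν (ContinuousLinearMap.lsmul ℝ ℝ).flip
      (g := fun q => f q.1) (hf.comp continuous_fst)

theorem tendsto_sum_sum_setIntegral [SecondCountableTopology X] {A B : Set X}
    (R : RiemannSystem A) (S : RiemannSystem B) (ρ : Measure (X × X)) [IsFiniteMeasure ρ]
    {g : (X × X) × (X × X) → ℝ} (hg : Continuous g) :
    Tendsto (fun q : ℕ × ℕ => ∑ j, ∑ k, ∫ y in R.part q.1 j ×ˢ S.part q.2 k,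
      g ((R.tag q.1 j, S.tag q.2 k), y) ∂ρ) (atTop ×ˢ atTop) (𝓝 (∫ y in A ×ˢ B, g (y, y) ∂ρ)) := by
  let J (q : ℕ × ℕ) := Fin (R.card q.1) × Fin (S.card q.2)
  let part (q : ℕ × ℕ) (j : J q) : Set (X × X) := R.part q.1 j.1 ×ˢ S.part q.2 j.2
  have hmeas (q) (j : J q) : MeasurableSet (part q j) :=
    (R.measurableSet_part _ _).prod (S.measurableSet_part _ _)
  have hdisj (q) : Pairwise fun j k : J q => Disjoint (part q j) (part q k) := fun j k hjk =>
    Set.disjoint_prod.2 <| (Prod.ext_iff.not.1 hjk |> not_and_or.1).imp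
      (R.disjoint_part _ ·) (S.disjoint_part _ ·)
  have hunion (q) : ⋃ j, part q j = A ×ˢ B := by
    rw [← R.iUnion_part q.1, ← S.iUnion_part q.2, Set.iUnion_prod']
    simp only [part, Set.prod_iUnion, Set.iUnion_prod_const]
    exact Set.iUnion_comm _
  have hmesh (δ : ℝ) (hδ : δ > 0) : ∀ᶠ q in (atTop ×ˢ atTop : Filter (ℕ × ℕ)), ∀ j,
      ∀ y ∈ part q j, dist y (R.tag q.1 j.1, S.tag q.2 j.2) < δ := by
    filter_upwards [(R.eventually_dist_lt hδ).prod_mk (S.eventually_dist_lt hδ)] with q hq j y hy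
    exact max_lt (hq.1 _ _ hy.1) (hq.2 _ _ hy.2)
  have hAB : MeasurableSet (A ×ˢ B) := hunion 0 ▸ .iUnion (hmeas 0)
  have := isFiniteMeasure_variation ρ.toSignedMeasure
  simpa only [VectorMeasure.setIntegral_toSignedMeasure, hAB, hmeas, part, J,
    Fintype.sum_prod_type] using tendsto_sum_setIntegral_tag hmeas hdisj hunion hmesh
      ρ.toSignedMeasure (ContinuousLinearMap.lsmul ℝ ℝ).flip hg

end RiemannSystem

end RiemannSums

theorem exists_disjoint_cover_ediam_le (X : Type*) [PseudoMetricSpace X] [CompactSpace X]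
    [Nonempty X] [MeasurableSpace X] [OpensMeasurableSpace X] {r : ℝ} (hr : 0 < r) :
    ∃ (f : ℕ → Set X) (N : ℕ), (∀ i, MeasurableSet (f i)) ∧ Pairwise (Function.onFun Disjoint f) ∧
      (∀ i, Metric.ediam (f i) ≤ 2 * ENNReal.ofReal r) ∧ ∀ x, ∃ i < N, x ∈ f i := by
  let ball (i : ℕ) : Set X := Metric.ball (TopologicalSpace.denseSeq X i) r
  have hcover : Set.univ ⊆ ⋃ i, ball i := fun x _ =>
    Set.mem_iUnion.2 ((TopologicalSpace.denseRange_denseSeq X).exists_dist_lt x hr)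
  obtain ⟨s, hs⟩ := isCompact_univ.elim_finite_subcover _ (fun _ => Metric.isOpen_ball) hcover
  refine ⟨disjointed ball, s.sup id + 1, .disjointed fun _ => Metric.isOpen_ball.measurableSet,
    disjoint_disjointed ball, fun i => ?_, fun x => ?_⟩
  · calc Metric.ediam (disjointed ball i) ≤ Metric.ediam (ball i) :=
          Metric.ediam_mono (disjointed_subset ball i)
      _ ≤ 2 * ENNReal.ofReal r := by
          simp only [ball, ← Metric.eball_ofReal]
          exact Metric.ediam_eball_le
  · obtain ⟨i, hi, hxi⟩ := Set.mem_iUnion₂.1 (hs (Set.mem_univ x))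
    have hmem : x ∈ ⋃ j ∈ Finset.Iic i, disjointed ball j := by
      rw [biUnion_Iic_disjointed]
      exact le_partialSups ball i hxi
    obtain ⟨j, hj, hxj⟩ := Set.mem_iUnion₂.1 hmem
    have hji : j ≤ s.sup id := (Finset.mem_Iic.1 hj).trans (Finset.le_sup (f := id) hi)
    exact ⟨j, Nat.lt_succ_of_le hji, hxj⟩

theorem nonempty_riemannSystem {X : Type*} [PseudoMetricSpace X] [CompactSpace X] [Nonempty X]
    [MeasurableSpace X] [OpensMeasurableSpace X] {D : Set X} (hD : MeasurableSet D) :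
    Nonempty (RiemannSystem D) := by
  classical
  choose f N hfm hfd hf_diam hf_cover using fun n : ℕ =>
    exists_disjoint_cover_ediam_le X (r := 1 / ((n : ℝ) + 1)) (by positivity)
  -- the partial sums of `N` are monotone, and the surplus parts are harmless
  let card (n : ℕ) : ℕ := ∑ i ∈ Finset.range (n + 1), (N i + 1)
  have hNcard (n) : N n ≤ card n :=
    (Nat.le_succ _).trans (Finset.single_le_sum (f := fun i => N i + 1) (fun _ _ => Nat.zero_le _)
      (Finset.self_mem_range_succ n))
  have hcard (n) : n ≤ card n :=
    calc n ≤ ∑ i ∈ Finset.range (n + 1), 1 := by simp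
      _ ≤ card n := Finset.sum_le_sum fun i _ => Nat.le_add_left 1 (N i)
  let part (n : ℕ) (j : Fin (card n)) : Set X := D ∩ f n j
  have hmesh (n) : ⨆ j, Metric.ediam (part n j) ≤ 2 * ENNReal.ofReal (1 / ((n : ℝ) + 1)) :=
    iSup_le fun j => (Metric.ediam_mono Set.inter_subset_right).trans (hf_diam n j)
  have hlim : Tendsto (fun n : ℕ => 2 * ENNReal.ofReal (1 / ((n : ℝ) + 1))) atTop (𝓝 0) := by
    simpa using ENNReal.Tendsto.const_mul (a := 2)
      (ENNReal.tendsto_ofReal tendsto_one_div_add_atTop_nhds_zero_nat) (by simp)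
  refine ⟨{
    card := card
    part := part
    tag := fun n j => if h : (part n j).Nonempty then h.some else Classical.arbitrary X
    card_mono := fun m n hmn => Finset.sum_le_sum_of_subset (by gcongr)
    card_tendsto := tendsto_atTop_mono hcard tendsto_id
    measurableSet_part := fun n j => hD.inter (hfm n j)
    disjoint_part := fun n i j hij => (hfd n (Fin.val_injective.ne hij)).mono
      Set.inter_subset_right Set.inter_subset_right
    iUnion_part := fun n => ?_
    mesh_tendsto := tendsto_of_tendsto_of_tendsto_of_le_of_le tendsto_const_nhds hlim
      (fun _ => zero_le) hmesh
    tag_mem := fun n j h => by simpa only [dif_pos h] using h.some_mem }⟩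
  refine (Set.iUnion_subset fun j => Set.inter_subset_left).antisymm fun x hx => ?_
  obtain ⟨i, hi, hxi⟩ := hf_cover n x
  exact Set.mem_iUnion.2 ⟨⟨i, hi.trans_le (hNcard n)⟩, hx, hxi⟩

section Kernels

/-- The real measures `K x` have the jointly continuous density `κ (x, ·)` with respect to the
reference measure `ρ`.  All kernels whose self-integrals are computed here are of this kind. -/
structure HasContinuousDensity {X Y : Type*} [TopologicalSpace X] [TopologicalSpace Y]
    [MeasurableSpace Y] (K : X → SignedMeasure Y) (ρ : Measure Y) (κ : X × Y → ℝ) : Prop where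
  continuous : Continuous κ
  apply_eq : ∀ x A, MeasurableSet A → K x A = ∫ y in A, κ (x, y) ∂ρ

theorem continuous_setIntegral_of_continuous {X Y : Type*} [TopologicalSpace X]
    [FirstCountableTopology X] [LocallyCompactSpace X] [TopologicalSpace Y] [CompactSpace Y]
    [MeasurableSpace Y] [OpensMeasurableSpace Y] (ρ : Measure Y) [IsFiniteMeasure ρ]
    {g : X × Y → ℝ} (hg : Continuous g) (A : Set Y) :
    Continuous fun x => ∫ y in A, g (x, y) ∂ρ := by
  simpa only [setIntegral_univ] using continuous_parametric_integral_of_continuous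
    (μ := ρ.restrict A) (f := fun x y => g (x, y)) hg isCompact_univ

namespace HasContinuousDensity

theorem isCfmKernel {X Y : Type*} [TopologicalSpace X] [FirstCountableTopology X]
    [LocallyCompactSpace X] [TopologicalSpace Y] [CompactSpace Y] [MeasurableSpace Y]
    [OpensMeasurableSpace Y] {K : X → SignedMeasure Y} {ρ : Measure Y} [IsFiniteMeasure ρ]
    {κ : X × Y → ℝ} (hK : HasContinuousDensity K ρ κ) : IsCfmKernel K := fun A hA => by
  simpa only [hK.apply_eq _ A hA] using continuous_setIntegral_of_continuous ρ hK.continuous A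

theorem isSelfIntegral {X : Type*} [PseudoMetricSpace X] [CompactSpace X] [MeasurableSpace X]
    [BorelSpace X] {K : X → SignedMeasure X} {ρ : Measure X} [IsFiniteMeasure ρ] {κ : X × X → ℝ}
    (hK : HasContinuousDensity K ρ κ) (D : Set X) :
    IsSelfIntegral K D (∫ x in D, κ (x, x) ∂ρ) := fun R => by
  simpa only [hK.apply_eq _ _ (R.measurableSet_part _ _)] using
    R.tendsto_sum_setIntegral ρ hK.continuous

theorem isQuasiSelfIntegral {X : Type*} [PseudoMetricSpace X] [CompactSpace X] [MeasurableSpace X]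
    [BorelSpace X] [SecondCountableTopology X] {L : X × X → SignedMeasure (X × X)}
    {ρ : Measure (X × X)} [IsFiniteMeasure ρ] {κ : (X × X) × (X × X) → ℝ}
    (hL : HasContinuousDensity L ρ κ) (A B : Set X) :
    IsQuasiSelfIntegral L A B (∫ q in A ×ˢ B, κ (q, q) ∂ρ) := fun R S => by
  simpa only [hL.apply_eq _ _ ((R.measurableSet_part _ _).prod (S.measurableSet_part _ _))] using
    R.tendsto_sum_sum_setIntegral S ρ hL.continuous

theorem secondOrderKernel {X Y : Type*} [TopologicalSpace X] [TopologicalSpace Y] [CompactSpace Y]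
    [SecondCountableTopology Y] [MeasurableSpace Y] [OpensMeasurableSpace Y]
    {K : X → SignedMeasure Y} {ρ : Measure Y} [IsFiniteMeasure ρ] {κ : X × Y → ℝ}
    (hK : HasContinuousDensity K ρ κ) :
    HasContinuousDensity (secondOrderKernel K) (ρ.prod ρ)
      fun q => κ (q.1.2, q.2.1) * κ (q.1.1, q.2.2) where
  continuous := (hK.continuous.comp (by fun_prop)).mul (hK.continuous.comp (by fun_prop))
  apply_eq := fun p E hE => by
    have hint : Integrable (fun y : Y × Y => κ (p.2, y.1) * κ (p.1, y.2)) (ρ.prod ρ) :=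
      ((hK.continuous.comp (by fun_prop)).mul
        (hK.continuous.comp (by fun_prop))).integrable_of_hasCompactSupport
          (HasCompactSupport.of_compactSpace _)
    rw [SelfIntegral.secondOrderKernel, VectorMeasure.prod_eq_of_forall_apply_prod
      (ρ := (ρ.prod ρ).withDensityᵥ fun y => κ (p.2, y.1) * κ (p.1, y.2)) fun A B hA hB => ?_,
      withDensityᵥ_apply hint hE]
    rw [withDensityᵥ_apply hint (hA.prod hB),
      setIntegral_prod_mul (fun y => κ (p.2, y)) fun y => κ (p.1, y), hK.apply_eq _ _ hA,
      hK.apply_eq _ _ hB]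
    rfl

end HasContinuousDensity

variable {X : Type*} [PseudoMetricSpace X] [CompactSpace X] [Nonempty X] [MeasurableSpace X]
  [OpensMeasurableSpace X]

theorem IsSelfIntegral.selfIntegrable {K : X → SignedMeasure X} {D : Set X}
    (hD : MeasurableSet D) {ℓ : ℝ} (h : IsSelfIntegral K D ℓ) : SelfIntegrable K D := by
  obtain ⟨R⟩ := nonempty_riemannSystem hD
  exact ⟨ℓ, h, fun ℓ' h' => tendsto_nhds_unique (h' R) (h R)⟩

theorem IsQuasiSelfIntegral.quasiSelfIntegrable {L : X × X → SignedMeasure (X × X)} {A B : Set X}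
    (hA : MeasurableSet A) (hB : MeasurableSet B) {ℓ : ℝ} (h : IsQuasiSelfIntegral L A B ℓ) :
    QuasiSelfIntegrable L A B := by
  obtain ⟨R⟩ := nonempty_riemannSystem hA
  obtain ⟨S⟩ := nonempty_riemannSystem hB
  exact ⟨ℓ, h, fun ℓ' h' => tendsto_nhds_unique (h' R S) (h R S)⟩

end Kernels

section InnerMeasure

variable {X E : Type*} [MeasurableSpace X] [NormedAddCommGroup E] [InnerProductSpace ℝ E]

/-- The real measure `A ↦ ⟪w, M A⟫`, through which the Hilbert space valued measure `M` is tested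
against the vector `w`. -/
noncomputable def innerMeasure (w : E) (M : VectorMeasure X E) : SignedMeasure X :=
  M.mapRange (innerSL ℝ w).toLinearMap.toAddMonoidHom (innerSL ℝ w).continuous

theorem innerMeasure_apply (w : E) (M : VectorMeasure X E) (A : Set X) :
    innerMeasure w M A = inner ℝ w (M A) := rfl

variable [TopologicalSpace X] [LinearOrder X] [OrderTopology X] [SecondCountableTopology X]
  [OrderTop X] [BorelSpace X] {M : VectorMeasure X E}

theorem inner_eq_of_inner_Iic {w : E} {ν : SignedMeasure X}
    (h : ∀ t, inner ℝ w (M (Set.Iic t)) = ν (Set.Iic t)) (A : Set X) :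
    inner ℝ w (M A) = ν A := by
  rw [← innerMeasure_apply, vectorMeasure_ext_Iic (μ := innerMeasure w M) (ν := ν) h]

theorem hasGramMeasure_of_inner_Iic {C : SignedMeasure (X × X)}
    (h : ∀ s t, inner ℝ (M (Set.Iic s)) (M (Set.Iic t)) = C (Set.Iic s ×ˢ Set.Iic t)) :
    HasGramMeasure M C := by
  have hfst (B : Set X) (hB : MeasurableSet B) (A : Set X) (hA : MeasurableSet A) :
      (C.restrict (Set.univ ×ˢ B)).map Prod.fst A = C (A ×ˢ B) := by
    rw [VectorMeasure.map_apply _ measurable_fst hA,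
      VectorMeasure.restrict_apply _ (MeasurableSet.univ.prod hB) (measurable_fst hA)]
    congr 1
    ext; simp
  have hsnd (A : Set X) (hA : MeasurableSet A) (B : Set X) (hB : MeasurableSet B) :
      (C.restrict (A ×ˢ Set.univ)).map Prod.snd B = C (A ×ˢ B) := by
    rw [VectorMeasure.map_apply _ measurable_snd hB,
      VectorMeasure.restrict_apply _ (hA.prod MeasurableSet.univ) (measurable_snd hB)]
    congr 1
    ext; simp [and_comm]
  intro A B hA hB
  rw [← hsnd A hA B hB]
  refine inner_eq_of_inner_Iic (fun t => ?_) B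
  rw [hsnd A hA _ measurableSet_Iic, ← hfst _ measurableSet_Iic A hA, real_inner_comm]
  refine inner_eq_of_inner_Iic (fun s => ?_) A
  rw [hfst _ measurableSet_Iic _ measurableSet_Iic, real_inner_comm, h]

end InnerMeasure

section StepFunctions

variable {X : Type*} [MeasurableSpace X]

/-- The indicator function of `A` as an element of `L²(μ)`. -/
noncomputable abbrev indLp (μ : Measure X) [IsFiniteMeasure μ] {A : Set X}
    (hA : MeasurableSet A) : Lp ℝ 2 μ :=
  indicatorConstLp 2 hA (measure_ne_top μ A) (1 : ℝ)

theorem exists_vectorMeasure_indLp (μ : Measure X) [IsFiniteMeasure μ] :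
    ∃ V : VectorMeasure X (Lp ℝ 2 μ), ∀ A (hA : MeasurableSet A), V A = indLp μ hA := by
  classical
  have hdiag : Measurable fun x : X => (x, x) := measurable_id.prodMk measurable_id
  have hgram : HasGramMeasure (fun A => if hA : MeasurableSet A then indLp μ hA else 0)
      (μ.map fun x => (x, x)).toSignedMeasure := fun A D hA hD => by
    simp only [hA, hD, dif_pos]
    rw [L2.real_inner_indicatorConstLp_one_indicatorConstLp_one,
      Measure.toSignedMeasure_apply_measurable (hA.prod hD),
      map_measureReal_apply hdiag (hA.prod hD)]
    rfl
  obtain ⟨V, hV⟩ := hgram.exists_vectorMeasure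
  exact ⟨V, fun A hA => by rw [hV A hA, dif_pos hA]⟩

/-- The step function with value `∑ c t` over all `t ≥ x`, that is, `∑ₜ c t • 1_(-∞, t]`. -/
noncomputable def stepFun {X : Type*} [LinearOrder X] (c : X →₀ ℝ) (x : X) : ℝ :=
  ∑ t ∈ c.support, c t * (Set.Iic t).indicator 1 x

theorem abs_stepFun_le {X : Type*} [LinearOrder X] (c : X →₀ ℝ) (x : X) :
    |stepFun c x| ≤ ∑ t ∈ c.support, |c t| := by
  refine (Finset.abs_sum_le_sum_abs _ _).trans (Finset.sum_le_sum fun t _ => ?_)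
  by_cases hx : x ∈ Set.Iic t <;> simp [hx]

variable [TopologicalSpace X] [LinearOrder X] [OrderTopology X] [BorelSpace X]

theorem measurable_stepFun (c : X →₀ ℝ) : Measurable (stepFun c) :=
  Finset.measurable_sum _ fun _ _ =>
    (measurable_one.indicator measurableSet_Iic).const_mul _

/-- The class of the step function `stepFun c` in `L²(μ)`, linear in `c`. -/
noncomputable def stepLp (μ : Measure X) [IsFiniteMeasure μ] : (X →₀ ℝ) →ₗ[ℝ] Lp ℝ 2 μ :=
  Finsupp.linearCombination ℝ fun t => indLp μ (measurableSet_Iic (a := t))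

theorem coeFn_stepLp (μ : Measure X) [IsFiniteMeasure μ] (c : X →₀ ℝ) :
    stepLp μ c =ᵐ[μ] stepFun c := by
  have hterm : ∀ t ∈ c.support, (c t • indLp μ (measurableSet_Iic (a := t)) : X → ℝ) =ᵐ[μ]
      fun x => c t * (Set.Iic t).indicator 1 x := fun t _ => by
    filter_upwards [indicatorConstLp_coeFn (p := 2) (hs := measurableSet_Iic (a := t))
      (hμs := measure_ne_top μ _) (c := (1 : ℝ))] with x hx
    rw [Pi.smul_apply, hx, smul_eq_mul]
    rfl
  filter_upwards [Lp.coeFn_finsetSum c.support fun t =>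
    c t • indLp μ (measurableSet_Iic (a := t)), (Finset.eventually_all _).2 hterm,
    (Finset.eventually_all c.support).2 fun t _ =>
      Lp.coeFn_smul (c t) (indLp μ (measurableSet_Iic (a := t)))] with x hsum hx hsmul
  rw [stepLp, Finsupp.linearCombination_apply, Finsupp.sum, hsum, Finset.sum_apply]
  exact Finset.sum_congr rfl fun t ht => (hsmul t ht).trans (hx t ht)

theorem norm_stepLp_sq (μ : Measure X) [IsFiniteMeasure μ] (c : X →₀ ℝ) :
    ‖stepLp μ c‖ ^ 2 = ∫ x, stepFun c x ^ 2 ∂μ := by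
  rw [← real_inner_self_eq_norm_sq, L2.inner_def]
  refine integral_congr_ae ?_
  filter_upwards [coeFn_stepLp μ c] with x hx
  simp [hx]

theorem integral_stepFun_mul_stepFun (γ : Measure (X × X)) [IsFiniteMeasure γ] (c : X →₀ ℝ) :
    ∫ q, stepFun c q.1 * stepFun c q.2 ∂γ =
      ∑ s ∈ c.support, ∑ t ∈ c.support, c s * c t * γ.real (Set.Iic s ×ˢ Set.Iic t) := by
  have hmeas (s t : X) : MeasurableSet (Set.Iic s ×ˢ Set.Iic t) :=
    measurableSet_Iic.prod measurableSet_Iic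
  have hint (s t : X) : Integrable
      (fun q : X × X => c s * c t * (Set.Iic s ×ˢ Set.Iic t).indicator 1 q) γ :=
    ((integrable_const 1).indicator (hmeas s t)).const_mul _
  have hexpand (q : X × X) : stepFun c q.1 * stepFun c q.2 = ∑ s ∈ c.support, ∑ t ∈ c.support,
      c s * c t * (Set.Iic s ×ˢ Set.Iic t).indicator 1 q := by
    simp only [stepFun, Finset.sum_mul_sum]
    refine Finset.sum_congr rfl fun s _ => Finset.sum_congr rfl fun t _ => ?_
    rw [← Prod.mk.eta (p := q), Set.indicator_prod_one, mul_mul_mul_comm]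
  simp_rw [hexpand]
  rw [integral_finsetSum _ fun s _ => integrable_finsetSum _ fun t _ => hint s t]
  refine Finset.sum_congr rfl fun s _ => ?_
  rw [integral_finsetSum _ fun t _ => hint s t]
  refine Finset.sum_congr rfl fun t _ => ?_
  rw [integral_const_mul, integral_indicator_one (hmeas s t)]

theorem integral_stepFun_mul_stepFun_le (γ : Measure (X × X)) [IsFiniteMeasure γ] (c : X →₀ ℝ) :
    ∫ q, stepFun c q.1 * stepFun c q.2 ∂γ ≤ ‖stepLp (γ.fst + γ.snd) c‖ ^ 2 := by
  -- the Schur test: `|ab| ≤ a² + b²` turns both factors into marginals of `γ`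
  have hsq (μ : Measure X) [IsFiniteMeasure μ] : Integrable (fun x => stepFun c x ^ 2) μ :=
    .of_bound ((measurable_stepFun c).pow_const 2).aestronglyMeasurable _
      (Eventually.of_forall fun x => by
        rw [norm_pow]; exact pow_le_pow_left₀ (norm_nonneg _) (abs_stepFun_le c x) 2)
  have hfst : Integrable (fun q => stepFun c q.1 ^ 2) γ :=
    (hsq γ.fst).comp_measurable measurable_fst
  have hsnd : Integrable (fun q => stepFun c q.2 ^ 2) γ :=
    (hsq γ.snd).comp_measurable measurable_snd
  rw [norm_stepLp_sq, integral_add_measure (hsq _) (hsq _), Measure.fst, Measure.snd,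
    integral_map measurable_fst.aemeasurable (hsq γ.fst).aestronglyMeasurable,
    integral_map measurable_snd.aemeasurable (hsq γ.snd).aestronglyMeasurable,
    ← integral_add hfst hsnd]
  have hyoung (q : X × X) :
      |stepFun c q.1 * stepFun c q.2| ≤ stepFun c q.1 ^ 2 + stepFun c q.2 ^ 2 := by
    rw [abs_le]
    constructor <;> nlinarith [sq_nonneg (stepFun c q.1 + stepFun c q.2),
      sq_nonneg (stepFun c q.1 - stepFun c q.2)]
  refine integral_mono ((hfst.add hsnd).mono' ?_ (Eventually.of_forall hyoung)) (hfst.add hsnd)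
    fun q => (le_abs_self _).trans (hyoung q)
  exact (((measurable_stepFun c).comp measurable_fst).mul
    ((measurable_stepFun c).comp measurable_snd)).aestronglyMeasurable

variable [SecondCountableTopology X] [OrderTop X]

theorem ae_eq_zero_of_setIntegral_Iic {μ : Measure X} {f : X → ℝ} (hf : Integrable f μ)
    (h : ∀ t, ∫ x in Set.Iic t, f x ∂μ = 0) : f =ᵐ[μ] 0 := by
  refine hf.ae_eq_of_withDensityᵥ_eq (integrable_zero _ _ _) ?_
  rw [withDensityᵥ_zero]
  refine vectorMeasure_ext_Iic fun t => ?_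
  rw [withDensityᵥ_apply hf measurableSet_Iic, h]
  rfl

theorem denseRange_stepLp (μ : Measure X) [IsFiniteMeasure μ] : DenseRange (stepLp μ) := by
  suffices h : (LinearMap.range (stepLp μ)).topologicalClosure = ⊤ from
    Submodule.dense_iff_topologicalClosure_eq_top.2 h
  rw [Submodule.topologicalClosure_eq_top_iff, Submodule.eq_bot_iff]
  intro f hf
  rw [stepLp, Finsupp.range_linearCombination, Submodule.mem_orthogonal] at hf
  have hint : Integrable f μ := (Lp.memLp f).integrable (by norm_num)
  refine Lp.ext ((ae_eq_zero_of_setIntegral_Iic hint fun t => ?_).trans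
    (Lp.coeFn_zero ℝ 2 _).symm)
  rw [← L2.inner_indicatorConstLp_one measurableSet_Iic (measure_ne_top μ _)]
  exact hf _ (Submodule.subset_span ⟨t, rfl⟩)

end StepFunctions

theorem exists_vectorMeasure_Iic_eq {X E : Type*} [TopologicalSpace X] [LinearOrder X]
    [OrderTopology X] [SecondCountableTopology X] [OrderTop X] [MeasurableSpace X] [BorelSpace X]
    [NormedAddCommGroup E] [InnerProductSpace ℝ E] [CompleteSpace E] {γ : Measure (X × X)}
    [IsFiniteMeasure γ] {z : X → E}
    (hz : ∀ s t, inner ℝ (z s) (z t) = γ.real (Set.Iic s ×ˢ Set.Iic t)) :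
    ∃ M : VectorMeasure X E, ∀ t, M (Set.Iic t) = z t := by
  set μ := γ.fst + γ.snd
  let f : (X →₀ ℝ) →ₗ[ℝ] E := Finsupp.linearCombination ℝ z
  have hbound (c) : ‖f c‖ ≤ 1 * ‖stepLp μ c‖ := by
    rw [one_mul]
    refine le_of_sq_le_sq ?_ (norm_nonneg _)
    calc ‖f c‖ ^ 2 = ∫ q, stepFun c q.1 * stepFun c q.2 ∂γ := by
          rw [integral_stepFun_mul_stepFun, ← real_inner_self_eq_norm_sq]
          simp only [f, Finsupp.linearCombination_apply, Finsupp.sum, sum_inner, inner_sum,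
            real_inner_smul_left, real_inner_smul_right, hz]
          rw [Finset.sum_comm]
          exact Finset.sum_congr rfl fun s _ => Finset.sum_congr rfl fun t _ => by ring
      _ ≤ ‖stepLp μ c‖ ^ 2 := integral_stepFun_mul_stepFun_le γ c
  obtain ⟨V, hV⟩ := exists_vectorMeasure_indLp μ
  let Λ := f.extendOfNorm (stepLp μ)
  refine ⟨V.mapRange Λ.toLinearMap.toAddMonoidHom Λ.continuous, fun t => ?_⟩
  calc Λ (V (Set.Iic t)) = Λ (stepLp μ (Finsupp.single t 1)) := by
        simp [hV _ measurableSet_Iic, stepLp]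
    _ = f (Finsupp.single t 1) := LinearMap.extendOfNorm_eq (denseRange_stepLp μ) ⟨_, hbound⟩ _
    _ = z t := by simp [f]

theorem exists_tendsto_of_tendsto_inner {E ι : Type*} [NormedAddCommGroup E]
    [InnerProductSpace ℝ E] [CompleteSpace E] [Nonempty ι] {S : ι → ℕ → E} {q : ℝ}
    (h : ∀ r r', Tendsto (fun p : ℕ × ℕ => inner ℝ (S r p.1) (S r' p.2)) (atTop ×ˢ atTop) (𝓝 q)) :
    ∃ y, ∀ r, Tendsto (S r) atTop (𝓝 y) := by
  have hnorm (r) : Tendsto (fun n => ‖S r n‖ ^ 2) atTop (𝓝 q) :=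
    ((h r r).comp (tendsto_id.prodMk tendsto_id)).congr fun n => real_inner_self_eq_norm_sq _
  have hdist (r r') :
      Tendsto (fun p : ℕ × ℕ => dist (S r p.1) (S r' p.2)) (atTop ×ˢ atTop) (𝓝 0) := by
    have hsq := (((hnorm r).comp tendsto_fst).sub ((h r r').const_mul 2)).add
      ((hnorm r').comp tendsto_snd)
    rw [show q - 2 * q + q = 0 by ring] at hsq
    have hsqrt := hsq.sqrt
    rw [Real.sqrt_zero] at hsqrt
    refine hsqrt.congr fun p => ?_
    rw [Function.comp_apply, Function.comp_apply, ← norm_sub_sq_real,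
      Real.sqrt_sq (norm_nonneg _), dist_eq_norm]
  obtain ⟨r₀⟩ := ‹Nonempty ι›
  have hcauchy : CauchySeq (S r₀) := by
    rw [cauchySeq_iff_tendsto_dist_atTop_0, ← prod_atTop_atTop_eq]
    exact hdist r₀ r₀
  obtain ⟨y, hy⟩ := cauchySeq_tendsto_of_complete hcauchy
  exact ⟨y, fun r => (tendsto_iff_of_dist
    ((hdist r₀ r).comp (tendsto_id.prodMk tendsto_id))).1 hy⟩

section DeterministicIntegral

variable {X E : Type*} [PseudoMetricSpace X] [CompactSpace X] [Nonempty X] [MeasurableSpace X]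
  [BorelSpace X] [SecondCountableTopology X] [NormedAddCommGroup E] [InnerProductSpace ℝ E]
  [CompleteSpace E]

theorem HasGramMeasure.exists_tendsto_sum_smul {N : Set X → E} {γ : Measure (X × X)}
    [IsFiniteMeasure γ] (hN : HasGramMeasure N γ.toSignedMeasure) {D : Set X}
    (hD : MeasurableSet D) {f : X → ℝ} (hf : Continuous f) :
    ∃ y, ∀ R : RiemannSystem D,
      Tendsto (fun n => ∑ j, f (R.tag n j) • N (R.part n j)) atTop (𝓝 y) := by
  have := nonempty_riemannSystem hD
  refine exists_tendsto_of_tendsto_inner (q := ∫ y in D ×ˢ D, f y.1 * f y.2 ∂γ) fun R S => ?_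
  have hg : Continuous fun q : (X × X) × (X × X) => f q.1.1 * f q.1.2 := by fun_prop
  refine (R.tendsto_sum_sum_setIntegral S γ hg).congr fun p => ?_
  simp only [setIntegral_const, sum_inner, inner_sum, real_inner_smul_left, real_inner_smul_right,
    hN _ _ (R.measurableSet_part _ _) (S.measurableSet_part _ _), smul_eq_mul,
    Measure.toSignedMeasure_apply_measurable
      ((R.measurableSet_part _ _).prod (S.measurableSet_part _ _))]
  rw [Finset.sum_comm]
  exact Finset.sum_congr rfl fun k _ => Finset.sum_congr rfl fun j _ => by ring

end DeterministicIntegral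

section UnitInterval

theorem setIntegral_Icc_unitInterval (f : ℝ → ℝ) {s t : unitInterval} (hst : s ≤ t) :
    ∫ u in Set.Icc s t, f u = ∫ u in (s : ℝ)..t, f u := by
  have h := unitInterval.measurePreserving_coe.setIntegral_preimage_emb
    unitInterval.measurableEmbedding_coe f (Set.Icc (s : ℝ) t)
  rw [Measure.restrict_restrict measurableSet_Icc,
    Set.inter_eq_left.2 (Set.Icc_subset_Icc s.2.1 t.2.2)] at h
  rw [intervalIntegral.integral_of_le hst, ← integral_Icc_eq_integral_Ioc, ← h]
  rfl

theorem setIntegral_Iic_unitInterval (f : ℝ → ℝ) (t : unitInterval) :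
    ∫ u in Set.Iic t, f u = ∫ u in (0 : ℝ)..t, f u := by
  rw [← Set.Icc_bot]
  exact setIntegral_Icc_unitInterval f bot_le

theorem setIntegral_Ici_unitInterval (f : ℝ → ℝ) (s : unitInterval) :
    ∫ u in Set.Ici s, f u = ∫ u in (s : ℝ)..1, f u := by
  rw [← Set.Icc_top]
  exact setIntegral_Icc_unitInterval f le_top

theorem integral_unitInterval (f : ℝ → ℝ) :
    ∫ u : unitInterval, f u = ∫ u in (0 : ℝ)..1, f u := by
  rw [← setIntegral_univ, ← Set.Iic_top]
  exact setIntegral_Iic_unitInterval f ⊤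

theorem integrable_unitInterval {f : ℝ → ℝ} (hf : IntervalIntegrable f volume 0 1) :
    Integrable fun u : unitInterval => f u :=
  (unitInterval.measurePreserving_coe.integrable_comp_emb
    unitInterval.measurableEmbedding_coe).2
      ((intervalIntegrable_iff_integrableOn_Icc_of_le zero_le_one).1 hf)

theorem integral_deriv_mul_measureReal_Iic (ρ : Measure unitInterval) [IsFiniteMeasure ρ]
    {φ : ℝ → ℝ} (hφ : ContDiff ℝ 1 φ) (h1 : φ 1 = 0) :
    ∫ t : unitInterval, deriv φ t * ρ.real (Set.Iic t) = -∫ x : unitInterval, φ x ∂ρ := by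
  have hd : Continuous (deriv φ) := hφ.continuous_deriv le_rfl
  let S : Set (unitInterval × unitInterval) := {q | q.2 ≤ q.1}
  have hint : Integrable (S.indicator fun q : unitInterval × unitInterval => deriv φ q.1)
      (volume.prod ρ) :=
    ((hd.comp (by fun_prop)).integrable_of_hasCompactSupport
      (HasCompactSupport.of_compactSpace _)).indicator
      (measurableSet_le measurable_snd measurable_fst)
  have hFTC (x : unitInterval) : ∫ t in Set.Ici x, deriv φ t = -φ x := by
    rw [setIntegral_Ici_unitInterval (deriv φ), intervalIntegral.integral_deriv_eq_sub
      (fun y _ => (hφ.differentiable one_ne_zero).differentiableAt) (hd.intervalIntegrable _ _),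
      h1, zero_sub]
  calc ∫ t : unitInterval, deriv φ t * ρ.real (Set.Iic t)
      = ∫ t : unitInterval, ∫ x, S.indicator (fun q => deriv φ q.1) (t, x) ∂ρ := by
        refine integral_congr_ae (Eventually.of_forall fun t => ?_)
        change _ = ∫ x, (Set.Iic t).indicator (fun _ => deriv φ t) x ∂ρ
        rw [integral_indicator_const _ measurableSet_Iic, smul_eq_mul, mul_comm]
    _ = ∫ x : unitInterval, (∫ t : unitInterval, S.indicator (fun q => deriv φ q.1) (t, x)) ∂ρ :=
        integral_integral_swap hint
    _ = ∫ x : unitInterval, -φ x ∂ρ := by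
        refine integral_congr_ae (Eventually.of_forall fun x => ?_)
        change ∫ t : unitInterval, (Set.Ici x).indicator (fun t => deriv φ t) t = _
        rw [integral_indicator measurableSet_Ici, hFTC]
    _ = -∫ x : unitInterval, φ x ∂ρ := integral_neg _

theorem integral_deriv_mul_apply_Iic (ν : SignedMeasure unitInterval) {φ : ℝ → ℝ}
    (hφ : ContDiff ℝ 1 φ) (h1 : φ 1 = 0) :
    ∫ t : unitInterval, deriv φ t * ν (Set.Iic t) = -∫ᵛ x : unitInterval, φ x ∂<•ν := by
  set p := ν.toJordanDecomposition.posPart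
  set n := ν.toJordanDecomposition.negPart
  have hν : ν = p.toSignedMeasure - n.toSignedMeasure :=
    ν.toSignedMeasure_toJordanDecomposition.symm
  have hφ_int (ρ : Measure unitInterval) [IsFiniteMeasure ρ] :
      ρ.toSignedMeasure.Integrable fun x : unitInterval => φ x := by
    have := isFiniteMeasure_variation ρ.toSignedMeasure
    exact (hφ.continuous.comp (by fun_prop)).integrable_of_hasCompactSupport
      (HasCompactSupport.of_compactSpace _)
  have hd_int (ρ : Measure unitInterval) [IsFiniteMeasure ρ] :
      Integrable fun t : unitInterval => deriv φ t * ρ.real (Set.Iic t) := by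
    have hmono : Monotone fun t : unitInterval => ρ.real (Set.Iic t) := fun s t hst =>
      measureReal_mono (Set.Iic_subset_Iic.2 hst)
    refine Integrable.mul_bdd (c := ρ.real Set.univ) (((hφ.continuous_deriv le_rfl).comp
      (by fun_prop)).integrable_of_hasCompactSupport (HasCompactSupport.of_compactSpace _))
      hmono.measurable.aestronglyMeasurable (Eventually.of_forall fun t => ?_)
    rw [Real.norm_of_nonneg measureReal_nonneg]
    exact measureReal_mono (Set.subset_univ _)
  rw [hν, VectorMeasure.integral_sub_vectorMeasure (hφ_int p) (hφ_int n),
    VectorMeasure.integral_toSignedMeasure, VectorMeasure.integral_toSignedMeasure, neg_sub',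
    ← integral_deriv_mul_measureReal_Iic p hφ h1, ← integral_deriv_mul_measureReal_Iic n hφ h1,
    ← integral_sub (hd_int p) (hd_int n)]
  refine integral_congr_ae (Eventually.of_forall fun t => ?_)
  simp only [sub_apply, Measure.toSignedMeasure_apply_measurable measurableSet_Iic, mul_sub]

theorem HasGramMeasure.tendsto_sum_smul_deriv {E : Type*} [NormedAddCommGroup E]
    [InnerProductSpace ℝ E] [CompleteSpace E] {M : VectorMeasure unitInterval E}
    {γ : Measure (unitInterval × unitInterval)} [IsFiniteMeasure γ]
    (hM : HasGramMeasure M γ.toSignedMeasure) (hcont : Continuous fun t => M (Set.Iic t))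
    {φ : ℝ → ℝ} (hφ : ContDiff ℝ 1 φ) (h1 : φ 1 = 0)
    (R : RiemannSystem (Set.univ : Set unitInterval)) :
    Tendsto (fun n => ∑ j, φ (R.tag n j) • M (R.part n j)) atTop
      (𝓝 (-∫ t : unitInterval, deriv φ t • M (Set.Iic t))) := by
  have hφc : Continuous fun t : unitInterval => φ t := hφ.continuous.comp (by fun_prop)
  have hint : Integrable fun t : unitInterval => deriv φ t • M (Set.Iic t) :=
    (((hφ.continuous_deriv le_rfl).comp (by fun_prop)).smul hcont).integrable_of_hasCompactSupport
      (HasCompactSupport.of_compactSpace _)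
  obtain ⟨y, hy⟩ := hM.exists_tendsto_sum_smul MeasurableSet.univ hφc
  convert hy R
  refine ext_inner_left ℝ fun w => ?_
  have hlim := ((innerSL ℝ w).continuous.tendsto y).comp (hy R)
  simp only [Function.comp_def, map_sum, map_smul, innerSL_apply_apply, smul_eq_mul,
    ← innerMeasure_apply] at hlim
  have hsum := R.tendsto_sum_mul_signedMeasure (innerMeasure w M) hφc
  rw [VectorMeasure.restrict_univ] at hsum
  rw [tendsto_nhds_unique hlim hsum, inner_neg_right, ← integral_inner hint, neg_eq_iff_eq_neg,
    ← integral_deriv_mul_apply_Iic _ hφ h1]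
  simp only [inner_smul_right, innerMeasure_apply]

end UnitInterval

section TestFunctions

theorem exists_smooth_tendsto_indicator_Ioo {a b : ℝ} (hab : a < b) :
    ∃ φ : ℕ → ℝ → ℝ, (∀ n, ContDiff ℝ ((⊤ : ℕ∞) : WithTop ℕ∞) (φ n)) ∧
      (∀ n, HasCompactSupport (φ n)) ∧ (∀ n, tsupport (φ n) ⊆ Set.Ioo a b) ∧
      (∀ n x, |φ n x| ≤ 1) ∧
      ∀ x, Tendsto (fun n => φ n x) atTop (𝓝 ((Set.Ioo a b).indicator (fun _ => (1 : ℝ)) x)) := by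
  obtain ⟨r, hr_mono, hr_mem, hr_lim⟩ :=
    exists_seq_strictMono_tendsto' (show (0 : ℝ) < (b - a) / 2 by linarith)
  let f : (n : ℕ) → ContDiffBump ((a + b) / 2) := fun n =>
    ⟨r n, r (n + 1), (hr_mem n).1, hr_mono n.lt_succ_self⟩
  have hball : Metric.ball ((a + b) / 2) ((b - a) / 2) = Set.Ioo a b := by
    rw [Real.ball_eq_Ioo]
    congr 1 <;> ring
  refine ⟨fun n => f n, fun n => (f n).contDiff, fun n => (f n).hasCompactSupport, fun n => ?_,
    fun n x => by rw [abs_of_nonneg (f n).nonneg]; exact (f n).le_one, fun x => ?_⟩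
  · rw [(f n).tsupport_eq, ← hball]
    exact Metric.closedBall_subset_ball (hr_mem (n + 1)).2
  rw [← hball]
  by_cases hx : x ∈ Metric.ball ((a + b) / 2) ((b - a) / 2)
  · rw [Set.indicator_of_mem hx]
    refine tendsto_const_nhds.congr' ?_
    filter_upwards [hr_lim.eventually_const_lt (Metric.mem_ball.1 hx)] with n hn
    exact ((f n).one_of_mem_closedBall hn.le).symm
  · rw [Set.indicator_of_notMem hx]
    refine tendsto_const_nhds.congr fun n => ((f n).zero_of_le_dist ?_).symm
    exact (hr_mem (n + 1)).2.le.trans (not_lt.1 hx)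

variable {ν : SignedMeasure unitInterval}

theorem signedMeasure_Ioo_eq_zero_of_smooth
    (h : ∀ φ : ℝ → ℝ, ContDiff ℝ ((⊤ : ℕ∞) : WithTop ℕ∞) φ → HasCompactSupport φ →
      tsupport φ ⊆ Set.Ioo 0 1 → ∫ᵛ x : unitInterval, φ x ∂<•ν = 0)
    (a b : unitInterval) : ν (Set.Ioo a b) = 0 := by
  have := isFiniteMeasure_variation ν
  rcases le_or_gt b a with hba | hab
  · simp [Set.Ioo_eq_empty hba.not_gt]
  obtain ⟨φ, hsmooth, hcompact, hsupp, hle, hlim⟩ :=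
    exists_smooth_tendsto_indicator_Ioo (Subtype.coe_lt_coe.2 hab)
  have hzero : ∀ n, ∫ᵛ x : unitInterval, φ n x ∂<•ν = 0 := fun n =>
    h _ (hsmooth n) (hcompact n) ((hsupp n).trans (Set.Ioo_subset_Ioo a.2.1 b.2.2))
  have hindicator : ∫ᵛ x : unitInterval, (Set.Ioo a b).indicator (fun _ => (1 : ℝ)) x ∂<•ν =
      ν (Set.Ioo a b) := by
    rw [VectorMeasure.integral_indicator_const _ measurableSet_Ioo]
    simp
  have htendsto : Tendsto (fun n => ∫ᵛ x : unitInterval, φ n x ∂<•ν) atTop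
      (𝓝 (∫ᵛ x : unitInterval, (Set.Ioo a b).indicator (fun _ => (1 : ℝ)) x ∂<•ν)) :=
    VectorMeasure.tendsto_integral_of_dominated_convergence (fun _ => (1 : ℝ))
      (fun n => ((hsmooth n).continuous.comp continuous_subtype_val).aestronglyMeasurable)
      (integrable_const _) (fun n => Eventually.of_forall fun x => hle n x)
      (Eventually.of_forall fun x => hlim x)
  rw [← hindicator]
  refine tendsto_nhds_unique htendsto ?_
  simp only [hzero, tendsto_const_nhds]

theorem signedMeasure_eq_zero_of_smooth
    (h : ∀ φ : ℝ → ℝ, ContDiff ℝ ((⊤ : ℕ∞) : WithTop ℕ∞) φ → HasCompactSupport φ →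
      tsupport φ ⊆ Set.Ioo 0 1 → ∫ᵛ x : unitInterval, φ x ∂<•ν = 0)
    (h0 : ν {0} = 0) (h1 : ν {1} = 0) : ν = 0 := by
  have hIoi : ∀ t : unitInterval, ν (Set.Ioi t) = 0 := fun t => by
    rcases (unitInterval.le_one' (t := t)).eq_or_lt with rfl | ht
    · simp [show Set.Ioi (1 : unitInterval) = ∅ from isMax_top.Ioi_eq]
    · rw [← Set.Ioc_top, ← Set.Ioo_union_right (show t < ⊤ from ht),
        VectorMeasure.of_union (by simp) measurableSet_Ioo (measurableSet_singleton _),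
        signedMeasure_Ioo_eq_zero_of_smooth h, zero_add]
      exact h1
  have hsplit : ∀ t : unitInterval, ν (Set.Iic t) = ν Set.univ := fun t => by
    rw [← VectorMeasure.of_add_of_sdiff (v := ν) measurableSet_Iic MeasurableSet.univ
      (Set.subset_univ (Set.Iic t)), ← Set.compl_eq_univ_sdiff, Set.compl_Iic, hIoi, add_zero]
  refine vectorMeasure_ext_Iic fun t => ?_
  rw [hsplit, ← hsplit 0, _root_.zero_apply, ← h0]
  congr 1
  exact Set.Iic_bot

end TestFunctions

section DerivativeRandomMeasure

variable {Ω : Type*} [MeasurableSpace Ω] {P : Measure Ω}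

theorem tendsto_eLpNorm_sub_iff {f : ℕ → Ω → ℝ} {F : ℕ → Lp ℝ 2 P} (h : ∀ n, F n =ᵐ[P] f n)
    (Y : Lp ℝ 2 P) :
    Tendsto (fun n => eLpNorm (fun ω => f n ω - Y ω) 2 P) atTop (𝓝 0) ↔
      Tendsto F atTop (𝓝 Y) := by
  rw [Lp.tendsto_Lp_iff_tendsto_eLpNorm']
  refine tendsto_congr fun n => eLpNorm_congr_ae ?_
  filter_upwards [h n] with ω hω
  simp only [Pi.sub_apply, hω]

theorem isStochIntegral_deterministic_iff {X : Type*} [PseudoEMetricSpace X] [MeasurableSpace X]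
    {f : X → ℝ} {M : VectorMeasure X (Lp ℝ 2 P)} {D : Set X} {Y : Lp ℝ 2 P} :
    IsStochIntegral 2 P (fun t _ => f t) M D Y ↔ ∀ R : RiemannSystem D,
      Tendsto (fun n => ∑ j, f (R.tag n j) • M (R.part n j)) atTop (𝓝 Y) := by
  refine forall_congr' fun R => tendsto_eLpNorm_sub_iff (fun n => ?_) Y
  have hsmul : ∀ j ∈ Finset.univ,
      ((f (R.tag n j) • M (R.part n j) : Lp ℝ 2 P) : Ω → ℝ) =ᵐ[P]
        fun ω => f (R.tag n j) * (M (R.part n j) : Ω → ℝ) ω := fun j _ =>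
    Lp.coeFn_smul _ _
  filter_upwards [Lp.coeFn_finsetSum Finset.univ fun j => f (R.tag n j) • M (R.part n j),
    (Finset.eventually_all _).2 hsmul] with ω hsum hω
  rw [hsum, Finset.sum_apply]
  exact Finset.sum_congr rfl hω

theorem inner_one_eq_integral [IsFiniteMeasure P] (w : Lp ℝ 2 P) :
    inner ℝ (indicatorConstLp 2 MeasurableSet.univ (measure_ne_top P _) (1 : ℝ)) w =
      ∫ ω, w ω ∂P := by
  rw [L2.inner_indicatorConstLp_one, Measure.restrict_univ]

theorem covariance_eq_inner [IsProbabilityMeasure P] {Y Z : Ω → ℝ} (hY : MemLp Y 2 P)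
    (hZ : MemLp Z 2 P) :
    cov[Y, Z; P] = inner ℝ (hY.toLp Y) (hZ.toLp Z) - (∫ ω, Y ω ∂P) * ∫ ω, Z ω ∂P := by
  rw [covariance_eq_sub hY hZ, L2.inner_def]
  congr 1
  refine integral_congr_ae ?_
  filter_upwards [hY.coeFn_toLp, hZ.coeFn_toLp] with ω hYω hZω
  rw [hYω, hZω, Pi.mul_apply, real_inner_eq_re_inner, mul_comm]
  rfl

theorem HasGramMeasure.isCovarianceMeasure {X : Type*} [MeasurableSpace X]
    [IsProbabilityMeasure P] {M : VectorMeasure X (Lp ℝ 2 P)} {C : SignedMeasure (X × X)}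
    (hC : HasGramMeasure M C) (hmean : ∀ A, ∫ ω, M A ω ∂P = 0) : IsCovarianceMeasure P M C :=
  fun A B hA hB => by
    rw [covariance_eq_inner (Lp.memLp _) (Lp.memLp _), Lp.toLp_coeFn, Lp.toLp_coeFn, hmean,
      zero_mul, sub_zero, hC A B hA hB]

variable {Z : unitInterval → Ω → ℝ} {hZ : ∀ t, MemLp (Z t) 2 P}
  {M : VectorMeasure unitInterval (Lp ℝ 2 P)}

theorem IsDerivativeRandomMeasure.eq {M' : VectorMeasure unitInterval (Lp ℝ 2 P)}
    (h : IsDerivativeRandomMeasure P Z hZ M) (h' : IsDerivativeRandomMeasure P Z hZ M') :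
    M = M' := by
  obtain ⟨R⟩ := nonempty_riemannSystem (D := (Set.univ : Set unitInterval)) MeasurableSet.univ
  have hzero : ∀ y : Lp ℝ 2 P, innerMeasure y (M - M') = 0 := fun y => by
    refine signedMeasure_eq_zero_of_smooth (fun φ hsmooth hcompact hsupp => ?_) ?_ ?_
    · have hM := isStochIntegral_deterministic_iff.1
        (h.isDistributionalDerivative φ hsmooth hcompact hsupp) R
      have hM' := isStochIntegral_deterministic_iff.1
        (h'.isDistributionalDerivative φ hsmooth hcompact hsupp) R
      have hdiff := (tendsto_const_nhds (x := y)).inner (𝕜 := ℝ) (hM.sub hM')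
      rw [sub_self, inner_zero_right] at hdiff
      have hφ : Continuous fun x : unitInterval => φ x :=
        hsmooth.continuous.comp continuous_subtype_val
      rw [← VectorMeasure.restrict_univ (innerMeasure y (M - M'))]
      refine tendsto_nhds_unique (R.tendsto_sum_mul_signedMeasure _ hφ) (hdiff.congr fun n => ?_)
      simp only [← Finset.sum_sub_distrib, ← smul_sub, inner_sum, inner_smul_right,
        innerMeasure_apply, _root_.sub_apply]
    · simp [innerMeasure_apply, h.zero_endpoint, h'.zero_endpoint]
    · simp [innerMeasure_apply, h.one_endpoint, h'.one_endpoint]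
  refine sub_eq_zero.1 (VectorMeasure.ext fun A _ => ext_inner_left ℝ fun y => ?_)
  rw [← innerMeasure_apply, hzero, _root_.zero_apply, _root_.zero_apply,
    inner_zero_right]

theorem integral_eq_zero_of_Iic [IsProbabilityMeasure P]
    (h : ∀ t, ∫ ω, M (Set.Iic t) ω ∂P = 0) (A : Set unitInterval) : ∫ ω, M A ω ∂P = 0 := by
  rw [← inner_one_eq_integral]
  refine inner_eq_of_inner_Iic (ν := 0) (fun t => ?_) A
  rw [inner_one_eq_integral, h, _root_.zero_apply]

theorem isDerivativeRandomMeasure_of_Iic [IsProbabilityMeasure P]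
    {γ : Measure (unitInterval × unitInterval)} [IsFiniteMeasure γ]
    (hM : HasGramMeasure M γ.toSignedMeasure) (hdiag : ∀ x, γ {(x, x)} = 0)
    (hIic : ∀ t, M (Set.Iic t) = (hZ t).toLp (Z t)) (hmean : ∀ t, ∫ ω, Z t ω ∂P = 0)
    (hcont : Continuous fun t => (hZ t).toLp (Z t)) : IsDerivativeRandomMeasure P Z hZ M := by
  have hsingleton : ∀ x, M {x} = 0 := fun x => by
    rw [← norm_eq_zero, ← sq_eq_zero_iff, ← real_inner_self_eq_norm_sq,
      hM _ _ (measurableSet_singleton x) (measurableSet_singleton x),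
      Set.singleton_prod_singleton, Measure.toSignedMeasure_apply_measurable
        (measurableSet_singleton _), measureReal_def, hdiag, ENNReal.toReal_zero]
  have hmeanM : ∀ A, ∫ ω, M A ω ∂P = 0 := integral_eq_zero_of_Iic fun t => by
    rw [hIic, integral_congr_ae (hZ t).coeFn_toLp, hmean]
  refine ⟨⟨_, hM.isCovarianceMeasure hmeanM⟩, fun φ hsmooth _ hsupp => ?_,
    hsingleton 0, hsingleton 1⟩
  have hφ1 : φ 1 = 0 := by
    by_contra h
    exact lt_irrefl _ (hsupp (subset_tsupport φ h)).2
  simp only [← hIic] at hcont ⊢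
  exact (isStochIntegral_deterministic_iff (f := fun t : unitInterval => φ t)).2 fun R =>
    hM.tendsto_sum_smul_deriv hcont (hsmooth.of_le (by exact_mod_cast le_top)) hφ1 R

end DerivativeRandomMeasure

section GaussianSubspaces

theorem deriv_eval_mul_exp_sq (p : Polynomial ℝ) (v : ℝ) :
    deriv (fun t => p.eval t * Real.exp (v * t ^ 2 / 2)) = fun t =>
      (p.derivative + .C v * .X * p).eval t * Real.exp (v * t ^ 2 / 2) := by
  ext t
  have hexp : HasDerivAt (fun t : ℝ => Real.exp (v * t ^ 2 / 2))
      (Real.exp (v * t ^ 2 / 2) * (v * (2 * t) / 2)) t := by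
    simpa using ((((hasDerivAt_id t).pow 2).const_mul v).div_const 2).exp
  rw [((p.hasDerivAt t).fun_mul hexp).deriv]
  simp only [Polynomial.eval_add, Polynomial.eval_mul, Polynomial.eval_C, Polynomial.eval_X]
  ring

theorem integral_pow_four_gaussianReal (v : NNReal) :
    ∫ x, x ^ 4 ∂(gaussianReal 0 v) = 3 * (v : ℝ) ^ 2 := by
  have hmgf : mgf (fun x => x) (gaussianReal 0 v) =
      fun t => (1 : Polynomial ℝ).eval t * Real.exp (v * t ^ 2 / 2) := by
    rw [mgf_fun_id_gaussianReal]
    simp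
  have hmoment : ∫ x, x ^ 4 ∂(gaussianReal 0 v) =
      iteratedDeriv 4 (mgf (fun x => x) (gaussianReal 0 v)) 0 := by
    rw [iteratedDeriv_mgf_zero] <;> simp
  rw [hmoment, hmgf]
  simp only [iteratedDeriv_succ, iteratedDeriv_zero, deriv_eval_mul_exp_sq]
  simp
  ring

variable {Ω : Type*} [MeasurableSpace Ω] {P : Measure Ω}

/-- The law of `w ∈ L²(P)` is a centred Gaussian distribution, possibly degenerate.  Its variance is
then necessarily `‖w‖²`, which makes the property visibly closed under `L²`-limits. -/
def IsCentredGaussian (P : Measure Ω) (w : Lp ℝ 2 P) : Prop :=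
  P.map w = gaussianReal 0 (‖w‖₊ ^ 2)

theorem isCentredGaussian_of_hasGaussianLaw {w : Lp ℝ 2 P} (h : HasGaussianLaw w P)
    (h0 : ∫ ω, w ω ∂P = 0) : IsCentredGaussian P w := by
  rw [IsCentredGaussian, h.map_eq_gaussianReal, h0]
  congr 1
  rw [variance_of_integral_eq_zero h.aemeasurable h0]
  ext
  rw [Real.coe_toNNReal _ (by positivity), NNReal.coe_pow, coe_nnnorm,
    ← real_inner_self_eq_norm_sq, L2.inner_def]
  simp [sq]

theorem IsCentredGaussian.memLp_four {w : Lp ℝ 2 P} (h : IsCentredGaussian P w) :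
    MemLp w 4 P := by
  have hid := memLp_id_gaussianReal' (μ := 0) (v := ‖w‖₊ ^ 2) 4 (by simp)
  rw [← h] at hid
  exact (memLp_map_measure_iff aestronglyMeasurable_id
    (Lp.aestronglyMeasurable w).aemeasurable).1 hid

theorem IsCentredGaussian.integral_pow_four {w : Lp ℝ 2 P} (h : IsCentredGaussian P w) :
    ∫ ω, w ω ^ 4 ∂P = 3 * inner ℝ w w ^ 2 := by
  have hmoment := integral_pow_four_gaussianReal (‖w‖₊ ^ 2)
  rw [← h, integral_map (Lp.aestronglyMeasurable w).aemeasurable (by fun_prop)] at hmoment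
  simpa [real_inner_self_eq_norm_sq] using hmoment

theorem isClosed_isCentredGaussian [IsProbabilityMeasure P] :
    IsClosed {w : Lp ℝ 2 P | IsCentredGaussian P w} := by
  refine IsSeqClosed.isClosed fun f w hf hw => ?_
  have : IsProbabilityMeasure (P.map w) :=
    Measure.isProbabilityMeasure_map (Lp.aestronglyMeasurable w).aemeasurable
  refine Measure.ext_of_charFun (funext fun t => ?_)
  obtain ⟨ns, hns, hae⟩ := (tendstoInMeasure_of_tendsto_Lp hw).exists_seq_tendsto_ae
  have hexp : Continuous fun x : ℝ => Complex.exp (t * x * Complex.I) := by fun_prop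
  have hchar : ∀ v : Lp ℝ 2 P, charFun (P.map v) t =
      ∫ ω, Complex.exp (t * (v ω : ℝ) * Complex.I) ∂P := fun v => by
    rw [charFun_apply_real, integral_map (Lp.aestronglyMeasurable v).aemeasurable
      (Continuous.aestronglyMeasurable (by fun_prop))]
  have hlaw : Tendsto (fun k => charFun (P.map (f (ns k))) t) atTop
      (𝓝 (charFun (P.map w) t)) := by
    simp only [hchar]
    refine tendsto_integral_of_dominated_convergence (fun _ => (1 : ℝ))
      (fun k => hexp.comp_aestronglyMeasurable (Lp.aestronglyMeasurable _))
      (integrable_const _) (fun k => Eventually.of_forall fun ω => ?_) ?_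
    · rw [← Complex.ofReal_mul, Complex.norm_exp_ofReal_mul_I]
    · filter_upwards [hae] with ω hω
      exact (hexp.tendsto _).comp hω
  have hgaussian : Tendsto (fun k => charFun (P.map (f (ns k))) t) atTop
      (𝓝 (charFun (gaussianReal 0 (‖w‖₊ ^ 2)) t)) := by
    have hfk : ∀ k, P.map (f (ns k)) = gaussianReal 0 (‖f (ns k)‖₊ ^ 2) := fun k => hf (ns k)
    simp only [hfk, charFun_gaussianReal]
    have hcont : Continuous fun v : Lp ℝ 2 P => Complex.exp ((t : ℂ) * ((0 : ℝ) : ℂ) * Complex.I -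
        (((‖v‖₊ ^ 2 : NNReal) : ℝ) : ℂ) * (t : ℂ) ^ 2 / 2) := by
      fun_prop
    exact (hcont.tendsto w).comp (hw.comp hns.tendsto_atTop)
  exact tendsto_nhds_unique hlaw hgaussian

/-- The closed linear span in `L²(P)` of a second-order process, which for a centred Gaussian
process is the Gaussian Hilbert space it generates. -/
noncomputable def closedSpan {T : Type*} {Z : T → Ω → ℝ} (hZ : ∀ t, MemLp (Z t) 2 P) :
    Submodule ℝ (Lp ℝ 2 P) :=
  (Submodule.span ℝ (Set.range fun t => (hZ t).toLp (Z t))).topologicalClosure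

theorem toLp_mem_closedSpan {T : Type*} {Z : T → Ω → ℝ} (hZ : ∀ t, MemLp (Z t) 2 P) (t : T) :
    (hZ t).toLp (Z t) ∈ closedSpan hZ :=
  Submodule.le_topologicalClosure _ (Submodule.subset_span ⟨t, rfl⟩)

theorem apply_mem_closedSpan_of_Iic {X : Type*} [MeasurableSpace X] [TopologicalSpace X]
    [LinearOrder X] [OrderTopology X] [SecondCountableTopology X] [BorelSpace X] [OrderTop X]
    {Z : X → Ω → ℝ} {hZ : ∀ t, MemLp (Z t) 2 P} {M : VectorMeasure X (Lp ℝ 2 P)}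
    (hM : ∀ t, M (Set.Iic t) = (hZ t).toLp (Z t)) (A : Set X) : M A ∈ closedSpan hZ := by
  have hclosed : IsClosed (closedSpan hZ : Set (Lp ℝ 2 P)) :=
    Submodule.isClosed_topologicalClosure _
  have : CompleteSpace (closedSpan hZ) := hclosed.completeSpace_coe
  rw [← Submodule.orthogonal_orthogonal (closedSpan hZ), Submodule.mem_orthogonal]
  intro y hy
  refine inner_eq_of_inner_Iic (ν := 0) (fun t => ?_) A
  rw [hM, real_inner_comm]
  exact (Submodule.mem_orthogonal _ _).1 hy _ (toLp_mem_closedSpan hZ t)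

theorem isCentredGaussian_of_mem_closedSpan [IsProbabilityMeasure P] {T : Type*} {Z : T → Ω → ℝ}
    (hZ : ∀ t, MemLp (Z t) 2 P) (hG : IsGaussianProcess Z P) (h0 : ∀ t, ∫ ω, Z t ω ∂P = 0)
    {w : Lp ℝ 2 P} (hw : w ∈ closedSpan hZ) : IsCentredGaussian P w := by
  refine closure_minimal (fun v hv => ?_) isClosed_isCentredGaussian hw
  obtain ⟨c, rfl⟩ := Finsupp.mem_span_range_iff_exists_finsupp.1 hv
  have hae : ((c.sum fun t a => a • (hZ t).toLp (Z t) : Lp ℝ 2 P) : Ω → ℝ) =ᵐ[P]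
      fun ω => ∑ t ∈ c.support, (c t • Z t ω) := by
    have hsmul : ∀ t ∈ c.support, ((c t • (hZ t).toLp (Z t) : Lp ℝ 2 P) : Ω → ℝ) =ᵐ[P]
        fun ω => c t • Z t ω := fun t _ => by
      filter_upwards [Lp.coeFn_smul (c t) ((hZ t).toLp (Z t)), (hZ t).coeFn_toLp] with ω h h'
      rw [h, Pi.smul_apply, h']
    filter_upwards [Lp.coeFn_finsetSum c.support fun t => c t • (hZ t).toLp (Z t),
      (Finset.eventually_all _).2 hsmul] with ω hsum hω
    rw [Finsupp.sum, hsum, Finset.sum_apply]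
    exact Finset.sum_congr rfl hω
  refine isCentredGaussian_of_hasGaussianLaw
    (HasGaussianLaw.congr ((hG.smul c).hasGaussianLaw_fun_sum) hae.symm) ?_
  rw [integral_congr_ae hae, integral_finsetSum (f := fun t ω => c t • Z t ω) _ fun t _ =>
    ((hZ t).integrable (by norm_num)).smul (c t)]
  simp [integral_const_mul, h0]

theorem memLp_mul_of_memLp_four {f g : Ω → ℝ} (hf : MemLp f 4 P) (hg : MemLp g 4 P) :
    MemLp (f * g) 2 P := by
  have : ENNReal.HolderTriple 4 4 2 := ⟨by
    rw [show (4 : ℝ≥0∞) = 2 * 2 by norm_num, ENNReal.mul_inv (by simp) (by simp), ← mul_add,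
      ENNReal.inv_two_add_inv_two, mul_one]⟩
  exact hg.mul hf

theorem integrable_mul_mul_mul {f g h k : Ω → ℝ} (hf : MemLp f 4 P) (hg : MemLp g 4 P)
    (hh : MemLp h 4 P) (hk : MemLp k 4 P) :
    Integrable (fun ω => f ω * g ω * (h ω * k ω)) P :=
  (memLp_mul_of_memLp_four hf hg).integrable_mul (memLp_mul_of_memLp_four hh hk)

section Isserlis

variable {V : Submodule ℝ (Lp ℝ 2 P)} (hV : ∀ w ∈ V, IsCentredGaussian P w) {a b c d : Lp ℝ 2 P}
include hV

theorem integral_sq_mul_sq_of_gaussian (ha : a ∈ V) (hb : b ∈ V) :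
    ∫ ω, a ω * a ω * (b ω * b ω) ∂P =
      inner ℝ a a * inner ℝ b b + 2 * inner ℝ a b ^ 2 := by
  have hint : ∀ w ∈ V, Integrable (fun ω => w ω ^ 4) P := fun w hw => by
    have hw4 := (hV w hw).memLp_four
    refine (integrable_mul_mul_mul hw4 hw4 hw4 hw4).congr (Eventually.of_forall fun ω => ?_)
    ring
  have hpolar : (fun ω => a ω * a ω * (b ω * b ω)) =ᵐ[P] fun ω =>
      (1 / 12) * ((a + b) ω ^ 4 + (a - b) ω ^ 4 - (2 * a ω ^ 4 + 2 * b ω ^ 4)) := by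
    filter_upwards [Lp.coeFn_add a b, Lp.coeFn_sub a b] with ω hadd hsub
    rw [hadd, hsub, Pi.add_apply, Pi.sub_apply]
    ring
  have hadd := V.add_mem ha hb
  have hsub := V.sub_mem ha hb
  rw [integral_congr_ae hpolar, integral_const_mul,
    integral_sub ((hint _ hadd).fun_add (hint _ hsub))
      (((hint a ha).const_mul 2).fun_add ((hint b hb).const_mul 2)),
    integral_add (hint _ hadd) (hint _ hsub),
    integral_add ((hint a ha).const_mul 2) ((hint b hb).const_mul 2), integral_const_mul,
    integral_const_mul, (hV _ hadd).integral_pow_four, (hV _ hsub).integral_pow_four,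
    (hV a ha).integral_pow_four, (hV b hb).integral_pow_four]
  simp only [inner_add_left, inner_add_right, inner_sub_left, inner_sub_right,
    real_inner_comm a b]
  ring

theorem integral_mul_mul_mul_of_gaussian (ha : a ∈ V) (hb : b ∈ V) (hc : c ∈ V) (hd : d ∈ V) :
    ∫ ω, a ω * b ω * (c ω * d ω) ∂P =
      inner ℝ a b * inner ℝ c d + inner ℝ a c * inner ℝ b d + inner ℝ a d * inner ℝ b c := by
  have hint : ∀ u ∈ V, ∀ v ∈ V, Integrable (fun ω => u ω * u ω * (v ω * v ω)) P :=
    fun u hu v hv =>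
      have hu4 := (hV u hu).memLp_four
      have hv4 := (hV v hv).memLp_four
      integrable_mul_mul_mul hu4 hu4 hv4 hv4
  have hpolar : (fun ω => a ω * b ω * (c ω * d ω)) =ᵐ[P] fun ω => (1 / 16) *
      (((a + b) ω * (a + b) ω * ((c + d) ω * (c + d) ω) -
        (a + b) ω * (a + b) ω * ((c - d) ω * (c - d) ω)) -
      ((a - b) ω * (a - b) ω * ((c + d) ω * (c + d) ω) -
        (a - b) ω * (a - b) ω * ((c - d) ω * (c - d) ω))) := by
    filter_upwards [Lp.coeFn_add a b, Lp.coeFn_sub a b, Lp.coeFn_add c d, Lp.coeFn_sub c d]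
      with ω habs habd hcds hcdd
    rw [habs, habd, hcds, hcdd]
    simp only [Pi.add_apply, Pi.sub_apply]
    ring
  have hab := V.add_mem ha hb
  have hab' := V.sub_mem ha hb
  have hcd := V.add_mem hc hd
  have hcd' := V.sub_mem hc hd
  have hint_sub : ∀ u ∈ V, Integrable (fun ω => u ω * u ω * ((c + d) ω * (c + d) ω) -
      u ω * u ω * ((c - d) ω * (c - d) ω)) P := fun u hu =>
    (hint u hu _ hcd).sub (hint u hu _ hcd')
  rw [integral_congr_ae hpolar, integral_const_mul,
    integral_sub (hint_sub _ hab) (hint_sub _ hab'),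
    integral_sub (hint _ hab _ hcd) (hint _ hab _ hcd'),
    integral_sub (hint _ hab' _ hcd) (hint _ hab' _ hcd'),
    integral_sq_mul_sq_of_gaussian hV hab hcd, integral_sq_mul_sq_of_gaussian hV hab hcd',
    integral_sq_mul_sq_of_gaussian hV hab' hcd, integral_sq_mul_sq_of_gaussian hV hab' hcd']
  simp only [inner_add_left, inner_add_right, inner_sub_left, inner_sub_right,
    real_inner_comm a b, real_inner_comm c d]
  ring

end Isserlis

end GaussianSubspaces

section StochasticIntegral

variable {Ω : Type*} [MeasurableSpace Ω] {P : Measure Ω}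

theorem IsCentredGaussian.integral_eq_zero {w : Lp ℝ 2 P} (h : IsCentredGaussian P w) :
    ∫ ω, w ω ∂P = 0 := by
  have hmean : ∫ x, x ∂(P.map w) = 0 := by rw [h, integral_id_gaussianReal]
  rwa [integral_map (Lp.aestronglyMeasurable w).aemeasurable (by fun_prop)] at hmean

variable {X : Type*} [PseudoMetricSpace X] [MeasurableSpace X] {Z : X → Ω → ℝ}
  {hZ : ∀ t, MemLp (Z t) 2 P}

/-- The situation in which `∫ Z dM` is constructed: `Z` is a centred Gaussian process which is
continuous in `L²(P)`, the measure `M` takes its values in the Gaussian Hilbert space of `Z` and has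
covariance measure `γ`, and the cross-covariances `Cov(Z t, M A) = ∫_A κ (t, u) dρ(u)` have a
continuous density. -/
structure IsGaussianIntegrator [IsProbabilityMeasure P] (hZ : ∀ t, MemLp (Z t) 2 P)
    (M : VectorMeasure X (Lp ℝ 2 P)) (ρ : Measure X) (κ : X × X → ℝ) (γ : Measure (X × X))
    [IsFiniteMeasure γ] : Prop where
  isCentredGaussian : ∀ w ∈ closedSpan hZ, IsCentredGaussian P w
  continuous_toLp : Continuous fun t => (hZ t).toLp (Z t)
  apply_mem : ∀ A, M A ∈ closedSpan hZ
  hasGramMeasure : HasGramMeasure M γ.toSignedMeasure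
  hasContinuousDensity : HasContinuousDensity (crossCovKernel P Z hZ M) ρ κ

/-- The covariance measure of `A ↦ ∫_A Z dM`, where `γ` is the covariance measure of `M` and `κ` the
density of the cross-covariances.  By Isserlis' theorem its density is formally
`Cov(Z u, dM v) Cov(Z v, dM u) + Cov(Z u, Z v) Cov(dM u, dM v)`. -/
noncomputable def stochIntegralCovariance (hZ : ∀ t, MemLp (Z t) 2 P) (ρ : Measure X)
    (κ : X × X → ℝ) (γ : Measure (X × X)) : SignedMeasure (X × X) :=
  (ρ.prod ρ).withDensityᵥ (fun q => κ (q.1, q.2) * κ (q.2, q.1)) +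
    γ.withDensityᵥ fun q => inner ℝ ((hZ q.1).toLp (Z q.1)) ((hZ q.2).toLp (Z q.2))

namespace IsGaussianIntegrator

variable [IsProbabilityMeasure P] {M : VectorMeasure X (Lp ℝ 2 P)} {ρ : Measure X} {κ : X × X → ℝ}
  {γ : Measure (X × X)} [IsFiniteMeasure γ] (h : IsGaussianIntegrator hZ M ρ κ γ)
include h

theorem memLp_mul (t : X) (A : Set X) : MemLp (Z t * (M A : Ω → ℝ)) 2 P :=
  memLp_mul_of_memLp_four
    ((h.isCentredGaussian _ (toLp_mem_closedSpan hZ t)).memLp_four.ae_eq (hZ t).coeFn_toLp)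
    (h.isCentredGaussian _ (h.apply_mem A)).memLp_four

theorem inner_toLp_apply (t : X) {A : Set X} (hA : MeasurableSet A) :
    inner ℝ ((hZ t).toLp (Z t)) (M A) = ∫ u in A, κ (t, u) ∂ρ := by
  have hcov := covariance_eq_inner (hZ t) (Lp.memLp (M A))
  rw [Lp.toLp_coeFn, (h.isCentredGaussian _ (h.apply_mem A)).integral_eq_zero, mul_zero,
    sub_zero] at hcov
  rw [← hcov, ← h.hasContinuousDensity.apply_eq t A hA, crossCovKernel_apply]

theorem inner_mul_mul (s t : X) {A D : Set X} (hA : MeasurableSet A) (hD : MeasurableSet D) :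
    inner ℝ ((h.memLp_mul s A).toLp _) ((h.memLp_mul t D).toLp _) =
      (∫ u in A, κ (s, u) ∂ρ) * (∫ u in D, κ (t, u) ∂ρ) +
      ((∫ u in D, κ (s, u) ∂ρ) * (∫ u in A, κ (t, u) ∂ρ) +
        inner ℝ ((hZ s).toLp (Z s)) ((hZ t).toLp (Z t)) * γ.real (A ×ˢ D)) := by
  have hfour : inner ℝ ((h.memLp_mul s A).toLp _) ((h.memLp_mul t D).toLp _) =
      ∫ ω, (hZ s).toLp (Z s) ω * M A ω * ((hZ t).toLp (Z t) ω * M D ω) ∂P := by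
    rw [L2.inner_def]
    refine integral_congr_ae ?_
    filter_upwards [(h.memLp_mul s A).coeFn_toLp, (h.memLp_mul t D).coeFn_toLp,
      (hZ s).coeFn_toLp, (hZ t).coeFn_toLp] with ω hsA htD hs ht
    rw [hsA, htD, hs, ht, RCLike.inner_apply', conj_trivial, Pi.mul_apply, Pi.mul_apply]
  rw [hfour, integral_mul_mul_mul_of_gaussian h.isCentredGaussian (toLp_mem_closedSpan hZ s)
    (h.apply_mem A) (toLp_mem_closedSpan hZ t) (h.apply_mem D),
    real_inner_comm ((hZ t).toLp (Z t)) (M A),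
    h.inner_toLp_apply s hA, h.inner_toLp_apply t hD, h.inner_toLp_apply s hD,
    h.inner_toLp_apply t hA, h.hasGramMeasure A D hA hD,
    Measure.toSignedMeasure_apply_measurable (hA.prod hD)]
  ring

/-- The Riemann sums of `∫ Z dM` as elements of `L²(P)`. -/
noncomputable def riemannSum {D : Set X} (R : RiemannSystem D) (n : ℕ) : Lp ℝ 2 P :=
  ∑ j, (h.memLp_mul (R.tag n j) (R.part n j)).toLp _

theorem isStochIntegral_iff {D : Set X} {Y : Lp ℝ 2 P} :
    IsStochIntegral 2 P Z M D Y ↔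
      ∀ R : RiemannSystem D, Tendsto (h.riemannSum R) atTop (𝓝 Y) := by
  refine forall_congr' fun R => tendsto_eLpNorm_sub_iff (fun n => ?_) Y
  filter_upwards [Lp.coeFn_finsetSum Finset.univ
      fun j => (h.memLp_mul (R.tag n j) (R.part n j)).toLp _,
    (Finset.eventually_all Finset.univ).2 fun j _ =>
      (h.memLp_mul (R.tag n j) (R.part n j)).coeFn_toLp] with ω hsum hω
  rw [riemannSum, hsum, Finset.sum_apply]
  exact Finset.sum_congr rfl hω

variable [CompactSpace X] [BorelSpace X]

theorem eq_of_isStochIntegral [Nonempty X] {A : Set X} (hA : MeasurableSet A) {Y Y' : Lp ℝ 2 P}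
    (hY : IsStochIntegral 2 P Z M A Y) (hY' : IsStochIntegral 2 P Z M A Y') : Y = Y' := by
  obtain ⟨R⟩ := nonempty_riemannSystem hA
  exact tendsto_nhds_unique (h.isStochIntegral_iff.1 hY R) (h.isStochIntegral_iff.1 hY' R)

variable [IsFiniteMeasure ρ]

theorem integral_eq [Nonempty X] {A : Set X} (hA : MeasurableSet A) {Y : Lp ℝ 2 P}
    (hY : IsStochIntegral 2 P Z M A Y) : ∫ ω, Y ω ∂P = ∫ u in A, κ (u, u) ∂ρ := by
  obtain ⟨R⟩ := nonempty_riemannSystem hA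
  have hmean := tendsto_const_nhds.inner (𝕜 := ℝ) (h.isStochIntegral_iff.1 hY R)
    (x := indicatorConstLp 2 MeasurableSet.univ (measure_ne_top P _) (1 : ℝ))
  rw [inner_one_eq_integral] at hmean
  refine tendsto_nhds_unique hmean
    ((R.tendsto_sum_setIntegral ρ h.hasContinuousDensity.continuous).congr fun n => ?_)
  rw [riemannSum, inner_sum]
  refine Finset.sum_congr rfl fun j _ => ?_
  rw [inner_one_eq_integral, ← h.inner_toLp_apply _ (R.measurableSet_part n j), L2.inner_def]
  refine integral_congr_ae ?_
  filter_upwards [(h.memLp_mul (R.tag n j) (R.part n j)).coeFn_toLp,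
    (hZ (R.tag n j)).coeFn_toLp] with ω hmul hω
  rw [hmul, hω, RCLike.inner_apply', conj_trivial, Pi.mul_apply]

variable [SecondCountableTopology X]

theorem stochIntegralCovariance_prod {A D : Set X} (hA : MeasurableSet A) (hD : MeasurableSet D) :
    stochIntegralCovariance hZ ρ κ γ (A ×ˢ D) =
      (∫ q in A ×ˢ D, κ (q.1, q.2) * κ (q.2, q.1) ∂ρ.prod ρ) +
      ∫ q in A ×ˢ D, inner ℝ ((hZ q.1).toLp (Z q.1)) ((hZ q.2).toLp (Z q.2)) ∂γ := by
  have hκ := h.hasContinuousDensity.continuous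
  have hz := h.continuous_toLp
  have hκκ : Continuous fun q : X × X => κ (q.1, q.2) * κ (q.2, q.1) :=
    (hκ.comp (by fun_prop)).mul (hκ.comp (by fun_prop))
  have hzz : Continuous fun q : X × X =>
      inner ℝ ((hZ q.1).toLp (Z q.1)) ((hZ q.2).toLp (Z q.2)) :=
    (hz.comp continuous_fst).inner (hz.comp continuous_snd)
  rw [stochIntegralCovariance, add_apply,
    withDensityᵥ_apply (hκκ.integrable_of_hasCompactSupport (.of_compactSpace _)) (hA.prod hD),
    withDensityᵥ_apply (hzz.integrable_of_hasCompactSupport (.of_compactSpace _)) (hA.prod hD)]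

theorem tendsto_inner_riemannSum {A D : Set X} (hA : MeasurableSet A) (hD : MeasurableSet D)
    (R : RiemannSystem A) (S : RiemannSystem D) :
    Tendsto (fun p : ℕ × ℕ => inner ℝ (h.riemannSum R p.1) (h.riemannSum S p.2)) (atTop ×ˢ atTop)
      (𝓝 ((∫ u in A, κ (u, u) ∂ρ) * (∫ u in D, κ (u, u) ∂ρ) +
        stochIntegralCovariance hZ ρ κ γ (A ×ˢ D))) := by
  let z (t : X) := (hZ t).toLp (Z t)
  have hz : Continuous z := h.continuous_toLp
  have hκ := h.hasContinuousDensity.continuous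
  have hmean := ((R.tendsto_sum_setIntegral ρ hκ).comp tendsto_fst).mul
    ((S.tendsto_sum_setIntegral ρ hκ).comp tendsto_snd)
  have hcross := R.tendsto_sum_sum_setIntegral S (ρ.prod ρ)
    (g := fun x => κ (x.1.1, x.2.2) * κ (x.1.2, x.2.1))
    ((hκ.comp (by fun_prop)).mul (hκ.comp (by fun_prop)))
  have hauto := R.tendsto_sum_sum_setIntegral S γ
    (g := fun x => inner ℝ (z x.1.1) (z x.1.2))
    ((hz.comp (by fun_prop)).inner (hz.comp (by fun_prop)))
  simp only [setIntegral_const, smul_eq_mul, mul_comm (γ.real _)] at hauto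
  rw [h.stochIntegralCovariance_prod hA hD]
  refine (hmean.add (hcross.add hauto)).congr fun p => ?_
  have hprod (s t : X) (A D : Set X) : ∫ q in A ×ˢ D, κ (s, q.2) * κ (t, q.1) ∂ρ.prod ρ =
      (∫ u in D, κ (s, u) ∂ρ) * ∫ u in A, κ (t, u) ∂ρ := by
    simp only [mul_comm (κ (s, _))]
    rw [setIntegral_prod_mul (fun u => κ (t, u)) (fun u => κ (s, u)), mul_comm]
  rw [riemannSum, riemannSum, sum_inner]
  simp only [inner_sum, Function.comp_apply, Finset.sum_mul_sum, hprod, z,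
    h.inner_mul_mul _ _ (R.measurableSet_part _ _) (S.measurableSet_part _ _),
    Finset.sum_add_distrib]

theorem exists_isStochIntegral [Nonempty X] {D : Set X} (hD : MeasurableSet D) :
    ∃ Y, IsStochIntegral 2 P Z M D Y := by
  have := nonempty_riemannSystem hD
  obtain ⟨Y, hY⟩ := exists_tendsto_of_tendsto_inner (h.tendsto_inner_riemannSum hD hD)
  exact ⟨Y, h.isStochIntegral_iff.2 hY⟩

theorem inner_eq [Nonempty X] {A D : Set X} (hA : MeasurableSet A) (hD : MeasurableSet D)
    {Y Y' : Lp ℝ 2 P} (hY : IsStochIntegral 2 P Z M A Y) (hY' : IsStochIntegral 2 P Z M D Y') :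
    inner ℝ Y Y' = (∫ u in A, κ (u, u) ∂ρ) * (∫ u in D, κ (u, u) ∂ρ) +
      stochIntegralCovariance hZ ρ κ γ (A ×ˢ D) := by
  obtain ⟨R⟩ := nonempty_riemannSystem hA
  obtain ⟨S⟩ := nonempty_riemannSystem hD
  exact tendsto_nhds_unique (((h.isStochIntegral_iff.1 hY R).comp tendsto_fst).inner
    ((h.isStochIntegral_iff.1 hY' S).comp tendsto_snd)) (h.tendsto_inner_riemannSum hA hD R S)

theorem stochIntegralUniquelyDefined [Nonempty X] {A : Set X} (hA : MeasurableSet A) :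
    StochIntegralUniquelyDefined 2 P Z M A :=
  (h.exists_isStochIntegral hA).imp fun _ hY =>
    ⟨hY, fun _ hY' => h.eq_of_isStochIntegral hA hY' hY⟩

theorem existsUnique_randomMeasure [Nonempty X] :
    ∃! N : VectorMeasure X (Lp ℝ 2 P),
      IsRandomMeasure P N ∧ ∀ A, MeasurableSet A → IsStochIntegral 2 P Z M A (N A) := by
  have hdiag : Integrable (fun q : X × X => κ (q.1, q.1) * κ (q.2, q.2)) (ρ.prod ρ) :=
    have hκ := h.hasContinuousDensity.continuous
    ((hκ.comp (by fun_prop)).mul (hκ.comp (by fun_prop))).integrable_of_hasCompactSupport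
      (.of_compactSpace _)
  choose! Y hY using fun (A : Set X) (hA : MeasurableSet A) => h.exists_isStochIntegral hA
  have hgram : HasGramMeasure Y ((ρ.prod ρ).withDensityᵥ
      (fun q => κ (q.1, q.1) * κ (q.2, q.2)) + stochIntegralCovariance hZ ρ κ γ) :=
    fun A D hA hD => by
      rw [h.inner_eq hA hD (hY A hA) (hY D hD), add_apply,
        withDensityᵥ_apply hdiag (hA.prod hD),
        setIntegral_prod_mul (fun u => κ (u, u)) fun v => κ (v, v)]
  obtain ⟨N, hNY⟩ := hgram.exists_vectorMeasure
  have hN : ∀ A, MeasurableSet A → IsStochIntegral 2 P Z M A (N A) := fun A hA => by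
    rw [hNY A hA]
    exact hY A hA
  refine ⟨N, ⟨⟨stochIntegralCovariance hZ ρ κ γ, fun A D hA hD => ?_⟩, hN⟩, fun N' hN' =>
    VectorMeasure.ext fun A hA => h.eq_of_isStochIntegral hA (hN'.2 A hA) (hN A hA)⟩
  rw [covariance_eq_inner (Lp.memLp _) (Lp.memLp _), Lp.toLp_coeFn, Lp.toLp_coeFn,
    h.inner_eq hA hD (hN A hA) (hN D hD), h.integral_eq hA (hN A hA), h.integral_eq hD (hN D hD),
    add_sub_cancel_left]

end IsGaussianIntegrator

end StochasticIntegral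

section SignedPower

/-- The signed power `|x| ^ p * sgn x`, which for `0 < p` is an odd primitive of
`x ↦ p * |x| ^ (p - 1)`. -/
noncomputable def signedRpow (p x : ℝ) : ℝ := |x| ^ p * Real.sign x

variable {p : ℝ}

theorem signedRpow_neg (p x : ℝ) : signedRpow p (-x) = -signedRpow p x := by
  rw [signedRpow, abs_neg, Real.sign_neg, mul_neg, signedRpow]

theorem signedRpow_of_nonneg (hp : p ≠ 0) {x : ℝ} (hx : 0 ≤ x) : signedRpow p x = x ^ p := by
  obtain rfl | hx := hx.eq_or_lt
  · rw [signedRpow, Real.sign_zero, mul_zero, Real.zero_rpow hp]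
  · rw [signedRpow, abs_of_pos hx, Real.sign_of_pos hx, mul_one]

theorem signedRpow_of_nonpos (hp : p ≠ 0) {x : ℝ} (hx : x ≤ 0) :
    signedRpow p x = -(-x) ^ p := by
  rw [← signedRpow_of_nonneg hp (neg_nonneg.2 hx), signedRpow_neg, neg_neg]

theorem signedRpow_mul_self (hp : 0 < p) (x : ℝ) :
    signedRpow p x * signedRpow p x = |x| ^ (2 * p) := by
  rw [two_mul, Real.rpow_add_of_nonneg (abs_nonneg x) hp.le hp.le]
  obtain hx | hx := le_total 0 x
  · rw [signedRpow_of_nonneg hp.ne' hx, abs_of_nonneg hx]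
  · rw [signedRpow_of_nonpos hp.ne' hx, abs_of_nonpos hx, neg_mul_neg]

theorem signedRpow_eq_max_sub_max (hp : p ≠ 0) (x : ℝ) :
    signedRpow p x = max x 0 ^ p - max (-x) 0 ^ p := by
  obtain hx | hx := le_total 0 x
  · rw [signedRpow_of_nonneg hp hx, max_eq_left hx, max_eq_right (neg_nonpos.2 hx),
      Real.zero_rpow hp, sub_zero]
  · rw [signedRpow_of_nonpos hp hx, max_eq_right hx, max_eq_left (neg_nonneg.2 hx),
      Real.zero_rpow hp, zero_sub]

theorem continuous_signedRpow (hp : 0 < p) : Continuous (signedRpow p) := by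
  simp only [funext (signedRpow_eq_max_sub_max hp.ne')]
  exact ((continuous_id.max continuous_const).rpow_const fun _ => Or.inr hp.le).sub
    ((continuous_neg.max continuous_const).rpow_const fun _ => Or.inr hp.le)

theorem hasDerivAt_signedRpow (hp : p ≠ 0) {x : ℝ} (hx : x ≠ 0) :
    HasDerivAt (signedRpow p) (p * |x| ^ (p - 1)) x := by
  obtain hneg | hpos := hx.lt_or_gt
  · have hderiv : HasDerivAt (fun y : ℝ => -(-y) ^ p) (-(-1 * p * (-x) ^ (p - 1))) x :=
      ((hasDerivAt_neg x).rpow_const (Or.inl (neg_ne_zero.2 hx))).neg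
    refine (hderiv.congr_deriv (by rw [abs_of_neg hneg]; ring)).congr_of_eventuallyEq ?_
    filter_upwards [Iio_mem_nhds hneg] with y hy using signedRpow_of_nonpos hp hy.le
  · refine ((Real.hasDerivAt_rpow_const (Or.inl hx)).congr_deriv
      (by rw [abs_of_pos hpos])).congr_of_eventuallyEq ?_
    filter_upwards [Ioi_mem_nhds hpos] with y hy using signedRpow_of_nonneg hp hy.le

theorem intervalIntegrable_abs_rpow {r : ℝ} (hr : -1 < r) (a b : ℝ) :
    IntervalIntegrable (fun v : ℝ => |v| ^ r) volume a b := by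
  refine intervalIntegrable_of_even (fun v => by rw [abs_neg]) fun c hc => ?_
  refine (intervalIntegral.intervalIntegrable_rpow' hr).congr fun v hv => ?_
  rw [Set.uIoc_of_le hc.le] at hv
  simp only [abs_of_pos hv.1]

theorem integral_abs_rpow_sub (hp : 0 < p) (u a b : ℝ) :
    ∫ v in a..b, |v - u| ^ (p - 1) = (signedRpow p (b - u) - signedRpow p (a - u)) / p := by
  have hftc := integral_eq_of_hasDerivAt_off_countable (a := a - u) (b := b - u) (s := {0})
    (signedRpow p) (fun v => p * |v| ^ (p - 1)) (Set.countable_singleton _)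
    (continuous_signedRpow hp).continuousOn (fun x hx => hasDerivAt_signedRpow hp.ne' hx.2)
    ((intervalIntegrable_abs_rpow (by linarith) _ _).const_mul p)
  rw [intervalIntegral.integral_const_mul] at hftc
  rw [intervalIntegral.integral_comp_sub_right (fun v => |v| ^ (p - 1)) u, ← hftc,
    mul_div_cancel_left₀ _ hp.ne']

theorem integral_signedRpow_sub (hp : 0 < p) (u a b : ℝ) :
    ∫ v in a..b, signedRpow p (v - u) =
      (|b - u| ^ (p + 1) - |a - u| ^ (p + 1)) / (p + 1) := by
  have hderiv (x : ℝ) : HasDerivAt (fun v => |v| ^ (p + 1)) ((p + 1) * signedRpow p x) x := by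
    refine (hasDerivAt_abs_rpow x (lt_add_of_pos_left 1 hp)).congr_deriv ?_
    obtain rfl | hx := eq_or_ne x 0
    · rw [signedRpow, Real.sign_zero, mul_zero, mul_zero, mul_zero]
    · rw [signedRpow, show p + 1 - 2 = p - 1 by ring, Real.rpow_sub_one (abs_ne_zero.2 hx)]
      obtain hneg | hpos := hx.lt_or_gt
      · rw [abs_of_neg hneg, Real.sign_of_neg hneg]
        field_simp
      · rw [abs_of_pos hpos, Real.sign_of_pos hpos]
        field_simp
  have hftc := intervalIntegral.integral_eq_sub_of_hasDerivAt (a := a - u) (b := b - u)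
    (fun x _ => hderiv x)
    (((continuous_signedRpow hp).intervalIntegrable _ _).const_mul (p + 1))
  rw [intervalIntegral.integral_const_mul] at hftc
  rw [intervalIntegral.integral_comp_sub_right (fun v => signedRpow p v) u, ← hftc,
    mul_div_cancel_left₀ _ (by positivity)]

end SignedPower

section FractionalCovariance

/-- The density `∂ᵤ ∂ᵥ Cov(B_H u, B_H v)` of the covariance measure of `B_H'`. -/
noncomputable def covDensity (H : ℝ) (q : unitInterval × unitInterval) : ℝ :=
  H * (2 * H - 1) * |(q.1 : ℝ) - q.2| ^ (2 * H - 2)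

/-- The density `∂ᵤ Cov(B_H t, B_H u)` at `q = (t, u)` of the kernel `K (t, ·)` of the theorem. -/
noncomputable def crossDensity (H : ℝ) (q : unitInterval × unitInterval) : ℝ :=
  H * ((q.2 : ℝ) ^ (2 * H - 1) + signedRpow (2 * H - 1) ((q.1 : ℝ) - q.2))

/-- The covariance function of fractional Brownian motion with Hurst index `H`. -/
noncomputable def covFun (H : ℝ) (q : unitInterval × unitInterval) : ℝ :=
  (|(q.1 : ℝ)| ^ (2 * H) + |(q.2 : ℝ)| ^ (2 * H) - |(q.1 : ℝ) - q.2| ^ (2 * H)) / 2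

/-- The covariance measure of `B_H'` as a positive measure, finite for `1 / 2 < H`. -/
noncomputable def covMeasure (H : ℝ) : Measure (unitInterval × unitInterval) :=
  volume.withDensity fun q => ENNReal.ofReal (covDensity H q)

variable {H : ℝ}

theorem covFun_comm (s t : unitInterval) : covFun H (s, t) = covFun H (t, s) := by
  rw [covFun, covFun, abs_sub_comm, add_comm (|(s : ℝ)| ^ (2 * H))]

theorem continuous_covFun (hH : 0 ≤ H) : Continuous (covFun H) := by
  have hpow {f : unitInterval × unitInterval → ℝ} (hf : Continuous f) :
      Continuous fun q => |f q| ^ (2 * H) := hf.abs.rpow_const fun _ => Or.inr (by positivity)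
  exact (((hpow (by fun_prop)).add (hpow (by fun_prop))).sub (hpow (by fun_prop))).div_const 2

theorem continuous_crossDensity (hH : 1 / 2 < H) : Continuous (crossDensity H) := by
  have hp : 0 < 2 * H - 1 := by linarith
  exact continuous_const.mul (((continuous_subtype_val.comp continuous_snd).rpow_const
    fun _ => Or.inr hp.le).add ((continuous_signedRpow hp).comp (by fun_prop)))

theorem crossDensity_nonneg (hH : 1 / 2 < H) (q : unitInterval × unitInterval) :
    0 ≤ crossDensity H q := by
  have hp : 0 < 2 * H - 1 := by linarith
  rw [crossDensity, signedRpow_eq_max_sub_max hp.ne']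
  have hle : max (-((q.1 : ℝ) - q.2)) 0 ^ (2 * H - 1) ≤ (q.2 : ℝ) ^ (2 * H - 1) :=
    Real.rpow_le_rpow (le_max_right _ _) (max_le (by linarith [q.1.2.1]) q.2.2.1) hp.le
  have hpos : 0 ≤ max ((q.1 : ℝ) - q.2) 0 ^ (2 * H - 1) := by positivity
  exact mul_nonneg (by linarith) (by linarith)

theorem setIntegral_Iic_crossDensity (hH : 1 / 2 < H) (s t : unitInterval) :
    ∫ u in Set.Iic s, crossDensity H (t, u) = covFun H (t, s) := by
  have hp : 0 < 2 * H - 1 := by linarith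
  have hsub (u : unitInterval) : crossDensity H (t, u) =
      H * (signedRpow (2 * H - 1) ((u : ℝ) - 0) - signedRpow (2 * H - 1) ((u : ℝ) - t)) := by
    rw [crossDensity, sub_zero, signedRpow_of_nonneg hp.ne' u.2.1, ← neg_sub (u : ℝ) t,
      signedRpow_neg, ← sub_eq_add_neg]
  have hint (c : ℝ) : IntervalIntegrable (fun u => signedRpow (2 * H - 1) (u - c)) volume 0 s :=
    ((continuous_signedRpow hp).comp (by fun_prop)).intervalIntegrable _ _
  simp only [hsub]
  rw [setIntegral_Iic_unitInterval
      (fun u => H * (signedRpow (2 * H - 1) (u - 0) - signedRpow (2 * H - 1) (u - t))),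
    intervalIntegral.integral_const_mul, intervalIntegral.integral_sub (hint 0) (hint t),
    integral_signedRpow_sub hp, integral_signedRpow_sub hp, covFun, abs_sub_comm (t : ℝ) s]
  simp only [sub_zero, zero_sub, abs_neg, abs_zero, sub_add_cancel,
    Real.zero_rpow (show 2 * H ≠ 0 by linarith)]
  have hH0 : H ≠ 0 := by linarith
  field_simp
  ring

theorem covDensity_nonneg (hH : 1 / 2 < H) (q : unitInterval × unitInterval) :
    0 ≤ covDensity H q :=
  mul_nonneg (mul_nonneg (by linarith) (by linarith)) (by positivity)

theorem measurable_covDensity : Measurable (covDensity H) := by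
  have habs : Measurable fun q : unitInterval × unitInterval => |(q.1 : ℝ) - q.2| := by fun_prop
  exact (habs.pow_const _).const_mul _

theorem integrable_covDensity_section (hH : 1 / 2 < H) (u : unitInterval) :
    Integrable fun v => covDensity H (u, v) := by
  have hint := (intervalIntegrable_abs_rpow (r := 2 * H - 2) (by linarith)
    (0 - (u : ℝ)) (1 - u)).comp_sub_right (u : ℝ)
  simp only [sub_add_cancel, abs_sub_comm _ (u : ℝ)] at hint
  exact (integrable_unitInterval hint).const_mul (H * (2 * H - 1))

theorem setIntegral_Iic_covDensity_section (hH : 1 / 2 < H) (u t : unitInterval) :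
    ∫ v in Set.Iic t, covDensity H (u, v) = crossDensity H (t, u) := by
  have hp : 0 < 2 * H - 1 := by linarith
  simp only [covDensity, abs_sub_comm (u : ℝ), show 2 * H - 2 = 2 * H - 1 - 1 by ring]
  rw [setIntegral_Iic_unitInterval (fun v => H * (2 * H - 1) * |v - u| ^ (2 * H - 1 - 1)),
    intervalIntegral.integral_const_mul, integral_abs_rpow_sub hp, zero_sub, signedRpow_neg,
    signedRpow_of_nonneg hp.ne' u.2.1, crossDensity, sub_neg_eq_add, mul_assoc,
    mul_div_cancel₀ _ hp.ne', add_comm]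

theorem integrable_covDensity (hH : 1 / 2 < H) : Integrable (covDensity H) := by
  rw [Measure.volume_eq_prod, integrable_prod_iff measurable_covDensity.aestronglyMeasurable]
  refine ⟨ae_of_all _ fun u => integrable_covDensity_section hH u, ?_⟩
  simp only [Real.norm_of_nonneg (covDensity_nonneg hH _)]
  rw [← funext fun u => setIntegral_univ (f := fun v => covDensity H (u, v)), ← Set.Iic_top]
  simp only [setIntegral_Iic_covDensity_section hH]
  exact ((continuous_crossDensity hH).comp (by fun_prop : Continuous fun u => (⊤, u))
    ).integrable_of_hasCompactSupport (.of_compactSpace _)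

theorem integrable_abs_sub_rpow (hH : 1 / 2 < H) :
    Integrable fun q : unitInterval × unitInterval => |(q.1 : ℝ) - q.2| ^ (2 * H - 2) :=
  have hc : H * (2 * H - 1) ≠ 0 := (mul_pos (by linarith) (by linarith)).ne'
  ((integrable_covDensity hH).const_mul (H * (2 * H - 1))⁻¹).congr
    (ae_of_all _ fun _ => inv_mul_cancel_left₀ hc _)

theorem isFiniteMeasure_covMeasure (hH : 1 / 2 < H) : IsFiniteMeasure (covMeasure H) :=
  isFiniteMeasure_withDensity_ofReal (integrable_covDensity hH).2

theorem covMeasure_real (hH : 1 / 2 < H) {E : Set (unitInterval × unitInterval)}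
    (hE : MeasurableSet E) : (covMeasure H).real E = ∫ q in E, covDensity H q := by
  rw [measureReal_def, covMeasure, withDensity_apply _ hE,
    integral_eq_lintegral_of_nonneg_ae (ae_of_all _ (covDensity_nonneg hH))
      measurable_covDensity.aestronglyMeasurable]

theorem covMeasure_real_Iic_prod_Iic (hH : 1 / 2 < H) (s t : unitInterval) :
    (covMeasure H).real (Set.Iic s ×ˢ Set.Iic t) = covFun H (s, t) := by
  rw [covMeasure_real hH (measurableSet_Iic.prod measurableSet_Iic), Measure.volume_eq_prod,
    setIntegral_prod _ (integrable_covDensity hH).integrableOn]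
  simp only [setIntegral_Iic_covDensity_section hH]
  rw [setIntegral_Iic_crossDensity hH, covFun_comm]

theorem covMeasure_singleton (q : unitInterval × unitInterval) : covMeasure H {q} = 0 :=
  withDensity_absolutelyContinuous _ _ (by
    rw [Measure.volume_eq_prod, ← Prod.mk.eta (p := q), ← Set.singleton_prod_singleton,
      Measure.prod_prod, measure_singleton, zero_mul])

end FractionalCovariance

section KernelIntegrals

variable {H p : ℝ}

theorem integral_crossDensity_diag (hH : 0 < H) : ∫ u, crossDensity H (u, u) = 1 / 2 := by
  simp only [crossDensity, sub_self, signedRpow, Real.sign_zero, mul_zero, add_zero]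
  rw [integral_unitInterval (fun u => H * u ^ (2 * H - 1)), intervalIntegral.integral_const_mul,
    integral_rpow (Or.inl (by linarith)), sub_add_cancel, Real.one_rpow,
    Real.zero_rpow (by positivity)]
  field_simp
  ring

theorem beta_eq_intervalIntegral {α β : ℝ} (hα : 0 < α) (hβ : 0 < β) :
    beta α β = ∫ x in (0 : ℝ)..1, x ^ (α - 1) * (1 - x) ^ (β - 1) := by
  have hcast : ∫ x in (0 : ℝ)..1, (x : ℂ) ^ ((α : ℂ) - 1) * (1 - (x : ℂ)) ^ ((β : ℂ) - 1) =
      ∫ x in (0 : ℝ)..1, ((x ^ (α - 1) * (1 - x) ^ (β - 1) : ℝ) : ℂ) := by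
    refine intervalIntegral.integral_congr fun x hx => ?_
    rw [Set.uIcc_of_le zero_le_one] at hx
    rw [Complex.ofReal_mul, Complex.ofReal_cpow hx.1, Complex.ofReal_cpow (sub_nonneg.2 hx.2)]
    push_cast
    rfl
  rw [beta_eq_betaIntegralReal α β hα hβ, Complex.betaIntegral, hcast,
    intervalIntegral.integral_ofReal, Complex.ofReal_re]

theorem integral_rpow_mul_signedRpow_section (hp : 0 < p) (u : unitInterval) :
    ∫ v : unitInterval, (u : ℝ) ^ p * signedRpow p ((v : ℝ) - u) =
      ((u : ℝ) ^ p * (1 - (u : ℝ)) ^ (p + 1) - (u : ℝ) ^ (2 * p + 1)) / (p + 1) := by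
  have hpow : (u : ℝ) ^ (2 * p + 1) = (u : ℝ) ^ p * (u : ℝ) ^ (p + 1) := by
    rw [← Real.rpow_add_of_nonneg u.2.1 hp.le (by positivity), two_mul, add_assoc]
  rw [integral_unitInterval (fun v => (u : ℝ) ^ p * signedRpow p (v - u)),
    intervalIntegral.integral_const_mul, integral_signedRpow_sub hp,
    abs_of_nonneg (sub_nonneg.2 u.2.2), zero_sub, abs_neg, abs_of_nonneg u.2.1, hpow,
    ← mul_sub, mul_div_assoc]

theorem continuous_rpow_mul_signedRpow (hp : 0 < p) :
    Continuous fun q : unitInterval × unitInterval =>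
      (q.1 : ℝ) ^ p * signedRpow p ((q.2 : ℝ) - q.1) :=
  ((continuous_subtype_val.comp continuous_fst).rpow_const fun _ => Or.inr hp.le).mul
    ((continuous_signedRpow hp).comp (by fun_prop))

theorem integral_rpow_mul_signedRpow (hp : 0 < p) :
    ∫ q : unitInterval × unitInterval, (q.1 : ℝ) ^ p * signedRpow p ((q.2 : ℝ) - q.1) =
      (beta (p + 1) (p + 2) - 1 / (2 * p + 2)) / (p + 1) := by
  have hbeta := beta_eq_intervalIntegral (α := p + 1) (β := p + 2) (by positivity) (by positivity)
  rw [add_sub_cancel_right, show p + 2 - 1 = p + 1 by ring] at hbeta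
  rw [Measure.volume_eq_prod, integral_prod _
    ((continuous_rpow_mul_signedRpow hp).integrable_of_hasCompactSupport (.of_compactSpace _))]
  simp only [integral_rpow_mul_signedRpow_section hp]
  have hpow {r : ℝ} (hr : 0 < r) : Continuous fun u : ℝ => u ^ r :=
    continuous_id.rpow_const fun _ => Or.inr hr.le
  have hprod : Continuous fun u : ℝ => u ^ p * (1 - u) ^ (p + 1) :=
    (hpow hp).mul ((hpow (by positivity)).comp (by fun_prop))
  rw [integral_unitInterval (fun u => (u ^ p * (1 - u) ^ (p + 1) - u ^ (2 * p + 1)) / (p + 1)),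
    intervalIntegral.integral_div, intervalIntegral.integral_sub (hprod.intervalIntegrable _ _)
      ((hpow (by positivity)).intervalIntegrable _ _), ← hbeta,
    integral_rpow (Or.inl (by linarith)), Real.one_rpow, Real.zero_rpow (by positivity)]
  ring_nf

theorem integral_abs_sub_rpow_section (hp : 0 < p + 1) (u : unitInterval) :
    ∫ v : unitInterval, |(v : ℝ) - u| ^ p =
      ((1 - (u : ℝ)) ^ (p + 1) + (u : ℝ) ^ (p + 1)) / (p + 1) := by
  have hsub := integral_abs_rpow_sub hp u 0 1
  rw [add_sub_cancel_right] at hsub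
  rw [integral_unitInterval (fun v => |v - u| ^ p), hsub, zero_sub, signedRpow_neg,
    signedRpow_of_nonneg hp.ne' u.2.1, signedRpow_of_nonneg hp.ne' (sub_nonneg.2 u.2.2),
    sub_neg_eq_add]

theorem continuous_abs_sub_rpow (hp : 0 ≤ p) :
    Continuous fun q : unitInterval × unitInterval => |(q.2 : ℝ) - q.1| ^ p :=
  Continuous.rpow_const (f := fun q : unitInterval × unitInterval => |(q.2 : ℝ) - q.1|)
    (by fun_prop) fun _ => Or.inr hp

theorem integral_abs_sub_rpow (hp : 0 ≤ p) :
    ∫ q : unitInterval × unitInterval, |(q.2 : ℝ) - q.1| ^ p = 2 / ((p + 1) * (p + 2)) := by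
  rw [Measure.volume_eq_prod, integral_prod _
    ((continuous_abs_sub_rpow hp).integrable_of_hasCompactSupport (.of_compactSpace _))]
  simp only [integral_abs_sub_rpow_section (show 0 < p + 1 by positivity)]
  have hpow : Continuous fun u : ℝ => u ^ (p + 1) :=
    continuous_id.rpow_const fun _ => Or.inr (by positivity)
  have hpow' : Continuous fun u : ℝ => (1 - u) ^ (p + 1) := hpow.comp (by fun_prop)
  rw [integral_unitInterval (fun u => ((1 - u) ^ (p + 1) + u ^ (p + 1)) / (p + 1)),
    intervalIntegral.integral_div, intervalIntegral.integral_add (hpow'.intervalIntegrable _ _)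
      (hpow.intervalIntegrable _ _),
    intervalIntegral.integral_comp_sub_left (fun u : ℝ => u ^ (p + 1)) 1, sub_zero, sub_self,
    integral_rpow (Or.inl (by linarith)), Real.one_rpow, Real.zero_rpow (by positivity)]
  field_simp
  ring

theorem integral_rpow_mul_rpow (hp : -1 < p) :
    ∫ q : unitInterval × unitInterval, (q.1 : ℝ) ^ p * (q.2 : ℝ) ^ p = (1 / (p + 1)) ^ 2 := by
  rw [Measure.volume_eq_prod, integral_prod_mul (fun u : unitInterval => (u : ℝ) ^ p)
    (fun u : unitInterval => (u : ℝ) ^ p), integral_unitInterval (fun u => u ^ p),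
    integral_rpow (Or.inl hp), Real.one_rpow, Real.zero_rpow (by linarith), sub_zero, sq]

theorem crossDensity_swap_mul (hp : 0 < 2 * H - 1) (q : unitInterval × unitInterval) :
    crossDensity H q.swap * crossDensity H q =
      H ^ 2 * ((q.1 : ℝ) ^ (2 * H - 1) * (q.2 : ℝ) ^ (2 * H - 1) -
        (q.2 : ℝ) ^ (2 * H - 1) * signedRpow (2 * H - 1) ((q.1 : ℝ) - q.2) -
        (q.1 : ℝ) ^ (2 * H - 1) * signedRpow (2 * H - 1) ((q.2 : ℝ) - q.1) -
        |(q.2 : ℝ) - q.1| ^ (2 * (2 * H - 1))) := by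
  rw [crossDensity, crossDensity, Prod.fst_swap, Prod.snd_swap, ← neg_sub (q.2 : ℝ) q.1,
    signedRpow_neg, ← signedRpow_mul_self hp]
  ring

theorem integral_crossDensity_swap_mul (hH : 1 / 2 < H) :
    ∫ q : unitInterval × unitInterval, crossDensity H q.swap * crossDensity H q =
      1 / 2 - H * beta (2 * H) (2 * H + 1) - H / (2 * (4 * H - 1)) := by
  have hp : 0 < 2 * H - 1 := by linarith
  simp only [crossDensity_swap_mul hp]
  set p := 2 * H - 1
  let f (q : unitInterval × unitInterval) : ℝ := (q.1 : ℝ) ^ p * (q.2 : ℝ) ^ p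
  let g (q : unitInterval × unitInterval) : ℝ := (q.1 : ℝ) ^ p * signedRpow p ((q.2 : ℝ) - q.1)
  let k (q : unitInterval × unitInterval) : ℝ := |(q.2 : ℝ) - q.1| ^ (2 * p)
  have hint {f : unitInterval × unitInterval → ℝ} (hf : Continuous f) : Integrable f :=
    hf.integrable_of_hasCompactSupport (.of_compactSpace _)
  have hpow : Continuous fun u : unitInterval => (u : ℝ) ^ p :=
    continuous_subtype_val.rpow_const fun _ => Or.inr hp.le
  have hf : Integrable f := hint ((hpow.comp continuous_fst).mul (hpow.comp continuous_snd))
  have hg : Integrable g := hint (continuous_rpow_mul_signedRpow hp)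
  have hk : Integrable k := hint (continuous_abs_sub_rpow (by positivity))
  have hswap : ∫ q : unitInterval × unitInterval, g q.swap = ∫ q, g q :=
    integral_prod_swap (μ := volume) (ν := volume) g
  have hsum : ∫ q, H ^ 2 * (f q - g q.swap - g q - k q) =
      H ^ 2 * ((∫ q, f q) - (∫ q, g q) - (∫ q, g q) - ∫ q, k q) := by
    have hgs : Integrable fun q : unitInterval × unitInterval => g q.swap := hg.swap
    have hfg : Integrable fun q => f q - g q.swap := hf.sub hgs
    rw [integral_const_mul, integral_sub (Integrable.sub' hfg hg) hk, integral_sub hfg hg,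
      integral_sub hf hgs, hswap]
  refine hsum.trans ?_
  rw [integral_rpow_mul_rpow (by linarith), integral_rpow_mul_signedRpow hp,
    integral_abs_sub_rpow (p := 2 * p) (by positivity), show p + 1 = 2 * H by ring,
    show p + 2 = 2 * H + 1 by ring, show 2 * p + 1 = 4 * H - 1 by ring,
    show 2 * p + 2 = 4 * H by ring]
  have : 4 * H - 1 ≠ 0 := by linarith
  have hH0 : H ≠ 0 := by linarith
  field_simp
  ring

end KernelIntegrals

section FractionalBrownianMotion

theorem continuous_of_continuous_inner {X E : Type*} [TopologicalSpace X] [NormedAddCommGroup E]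
    [InnerProductSpace ℝ E] {z : X → E} (hz : Continuous fun q : X × X => inner ℝ (z q.1) (z q.2)) :
    Continuous z := by
  refine continuous_iff_continuousAt.2 fun t => ?_
  have hcont : Continuous fun s =>
      inner ℝ (z s) (z s) - 2 * inner ℝ (z s) (z t) + inner ℝ (z t) (z t) :=
    ((hz.comp (by fun_prop : Continuous fun s => (s, s))).sub (continuous_const.mul
      (hz.comp (by fun_prop : Continuous fun s => (s, t))))).add continuous_const
  have hsq : Tendsto (fun s => ‖z s - z t‖ ^ 2) (𝓝 t) (𝓝 (‖z t - z t‖ ^ 2)) := by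
    simpa only [norm_sub_sq_real, real_inner_self_eq_norm_sq] using hcont.tendsto t
  rw [sub_self, norm_zero, sq, mul_zero] at hsq
  rw [ContinuousAt, tendsto_iff_norm_sub_tendsto_zero]
  simpa only [Real.sqrt_sq (norm_nonneg _), Real.sqrt_zero] using hsq.sqrt

namespace IsFractionalBrownianMotion

variable {Ω : Type*} [MeasurableSpace Ω] {P : Measure Ω} [IsProbabilityMeasure P] {H : ℝ}
  {B : unitInterval → Ω → ℝ} (hB : IsFractionalBrownianMotion H B P)
include hB

theorem inner_toLp (s t : unitInterval) :
    inner ℝ ((hB.memLp s).toLp (B s)) ((hB.memLp t).toLp (B t)) = covFun H (s, t) := by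
  have hcov := covariance_eq_inner (hB.memLp s) (hB.memLp t)
  rw [hB.centred, zero_mul, sub_zero, hB.cov_eq] at hcov
  exact hcov.symm

theorem continuous_toLp (hH : 0 ≤ H) : Continuous fun t => (hB.memLp t).toLp (B t) := by
  refine continuous_of_continuous_inner ?_
  simp only [hB.inner_toLp]
  exact continuous_covFun hH

theorem exists_vectorMeasure_Iic_eq (hH : 1 / 2 < H) :
    ∃ M : VectorMeasure unitInterval (Lp ℝ 2 P),
      ∀ t, M (Set.Iic t) = (hB.memLp t).toLp (B t) :=
  have := isFiniteMeasure_covMeasure hH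
  SelfIntegral.exists_vectorMeasure_Iic_eq (γ := covMeasure H) fun s t => by
    rw [hB.inner_toLp, covMeasure_real_Iic_prod_Iic hH]

variable {M : VectorMeasure unitInterval (Lp ℝ 2 P)}

theorem hasGramMeasure (hH : 1 / 2 < H) (hM : ∀ t, M (Set.Iic t) = (hB.memLp t).toLp (B t)) :
    haveI := isFiniteMeasure_covMeasure hH
    HasGramMeasure M (covMeasure H).toSignedMeasure :=
  have := isFiniteMeasure_covMeasure hH
  hasGramMeasure_of_inner_Iic fun s t => by
    rw [hM, hM, hB.inner_toLp, Measure.toSignedMeasure_apply_measurable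
      (measurableSet_Iic.prod measurableSet_Iic), covMeasure_real_Iic_prod_Iic hH]

theorem integral_apply (hM : ∀ t, M (Set.Iic t) = (hB.memLp t).toLp (B t))
    (A : Set unitInterval) : ∫ ω, M A ω ∂P = 0 :=
  integral_eq_zero_of_Iic (fun t => by
    rw [hM, integral_congr_ae (hB.memLp t).coeFn_toLp, hB.centred]) A

theorem isDerivativeRandomMeasure (hH : 1 / 2 < H)
    (hM : ∀ t, M (Set.Iic t) = (hB.memLp t).toLp (B t)) :
    IsDerivativeRandomMeasure P B hB.memLp M :=
  have := isFiniteMeasure_covMeasure hH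
  isDerivativeRandomMeasure_of_Iic (hB.hasGramMeasure hH hM) (fun _ => covMeasure_singleton _) hM
    hB.centred (hB.continuous_toLp (by linarith))

theorem crossCovKernel_eq (hH : 1 / 2 < H) (hM : ∀ t, M (Set.Iic t) = (hB.memLp t).toLp (B t))
    (t : unitInterval) {A : Set unitInterval} (hA : MeasurableSet A) :
    crossCovKernel P B hB.memLp M t A = ∫ u in A, crossDensity H (t, u) := by
  have hint : Integrable fun u => crossDensity H (t, u) :=
    ((continuous_crossDensity hH).comp (by fun_prop : Continuous fun u => (t, u))
      ).integrable_of_hasCompactSupport (.of_compactSpace _)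
  rw [crossCovKernel_apply, covariance_eq_inner (hB.memLp t) (Lp.memLp (M A)), hB.centred,
    zero_mul, sub_zero, Lp.toLp_coeFn, ← withDensityᵥ_apply hint hA]
  refine inner_eq_of_inner_Iic (fun s => ?_) A
  rw [hM, hB.inner_toLp, withDensityᵥ_apply hint measurableSet_Iic,
    setIntegral_Iic_crossDensity hH]

theorem hasContinuousDensity (hH : 1 / 2 < H)
    (hM : ∀ t, M (Set.Iic t) = (hB.memLp t).toLp (B t)) :
    HasContinuousDensity (crossCovKernel P B hB.memLp M) volume (crossDensity H) :=
  ⟨continuous_crossDensity hH, fun t _ => hB.crossCovKernel_eq hH hM t⟩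

theorem isGaussianIntegrator (hH : 1 / 2 < H)
    (hM : ∀ t, M (Set.Iic t) = (hB.memLp t).toLp (B t)) :
    haveI := isFiniteMeasure_covMeasure hH
    IsGaussianIntegrator hB.memLp M volume (crossDensity H) (covMeasure H) :=
  have := isFiniteMeasure_covMeasure hH
  { isCentredGaussian := fun _ hw => isCentredGaussian_of_mem_closedSpan hB.memLp
      hB.isGaussianProcess hB.centred hw
    continuous_toLp := hB.continuous_toLp (by linarith)
    apply_mem := apply_mem_closedSpan_of_Iic hM
    hasGramMeasure := hB.hasGramMeasure hH hM
    hasContinuousDensity := hB.hasContinuousDensity hH hM }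

theorem isSelfIntegral_crossCovKernel (hH : 1 / 2 < H)
    (hM : ∀ t, M (Set.Iic t) = (hB.memLp t).toLp (B t)) :
    IsSelfIntegral (crossCovKernel P B hB.memLp M) Set.univ (1 / 2) := by
  have hself := (hB.hasContinuousDensity hH hM).isSelfIntegral Set.univ
  rwa [setIntegral_univ, integral_crossDensity_diag (by linarith)] at hself

theorem isQuasiSelfIntegral_crossCovKernel (hH : 1 / 2 < H)
    (hM : ∀ t, M (Set.Iic t) = (hB.memLp t).toLp (B t)) :
    IsQuasiSelfIntegral (secondOrderKernel (crossCovKernel P B hB.memLp M)) Set.univ Set.univ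
      (1 / 2 - H * beta (2 * H) (2 * H + 1) - H / (2 * (4 * H - 1))) := by
  have hquasi := (hB.hasContinuousDensity hH hM).secondOrderKernel
    |>.isQuasiSelfIntegral Set.univ Set.univ
  rw [Set.univ_prod_univ, setIntegral_univ, ← Measure.volume_eq_prod] at hquasi
  rwa [← integral_crossDensity_swap_mul hH]

end IsFractionalBrownianMotion

end FractionalBrownianMotion

end SelfIntegral

theorem mainTheorem8 {Ω : Type*} [MeasurableSpace Ω] (P : Measure Ω) [IsProbabilityMeasure P]
    (H : ℝ) (hH : 1 / 2 < H) (hH1 : H < 1) (B : unitInterval → Ω → ℝ)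
    (hB : SelfIntegral.IsFractionalBrownianMotion H B P) :
    -- the derivative random measure of `B` exists and is unique
    (∃! M : VectorMeasure unitInterval (Lp ℝ 2 P),
      SelfIntegral.IsDerivativeRandomMeasure P B hB.memLp M) ∧
    ∀ M : VectorMeasure unitInterval (Lp ℝ 2 P),
      SelfIntegral.IsDerivativeRandomMeasure P B hB.memLp M →
      -- `M` is centred, has primitive `B`, and has the stated covariance measure
      (∀ A, MeasurableSet A → ∫ ω, M A ω ∂P = 0) ∧
      (∀ t : unitInterval, M (Set.Icc 0 t) =ᵐ[P] B t) ∧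
      Integrable (fun q : unitInterval × unitInterval =>
        |(q.1 : ℝ) - q.2| ^ (2 * H - 2)) ∧
      (∃ C : SignedMeasure (unitInterval × unitInterval),
        SelfIntegral.IsCovarianceMeasure P M C ∧
        ∀ E, MeasurableSet E →
          C E = H * (2 * H - 1) * ∫ q in E, |(q.1 : ℝ) - q.2| ^ (2 * H - 2)) ∧
      -- the cross-covariance kernel and its second-order kernel
      (∀ (t : unitInterval) (A : Set unitInterval), MeasurableSet A →
        SelfIntegral.crossCovKernel P B hB.memLp M t A =
          H * ∫ u in A, ((u : ℝ) ^ (2 * H - 1) +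
            |(t : ℝ) - u| ^ (2 * H - 1) * Real.sign ((t : ℝ) - u))) ∧
      (∀ (t : unitInterval) (A : Set unitInterval), MeasurableSet A →
        0 ≤ SelfIntegral.crossCovKernel P B hB.memLp M t A) ∧
      SelfIntegral.IsCfmKernel (SelfIntegral.crossCovKernel P B hB.memLp M) ∧
      SelfIntegral.IsCfmKernel
        (SelfIntegral.secondOrderKernel (SelfIntegral.crossCovKernel P B hB.memLp M)) ∧
      -- the self-integral
      SelfIntegral.SelfIntegrable (SelfIntegral.crossCovKernel P B hB.memLp M) Set.univ ∧
      SelfIntegral.IsSelfIntegral (SelfIntegral.crossCovKernel P B hB.memLp M) Set.univ (1 / 2) ∧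
      -- the quasi-self-integral
      SelfIntegral.QuasiSelfIntegrable
        (SelfIntegral.secondOrderKernel (SelfIntegral.crossCovKernel P B hB.memLp M))
        Set.univ Set.univ ∧
      SelfIntegral.IsQuasiSelfIntegral
        (SelfIntegral.secondOrderKernel (SelfIntegral.crossCovKernel P B hB.memLp M))
        Set.univ Set.univ
        (1 / 2 - H * ProbabilityTheory.beta (2 * H) (2 * H + 1) - H / (2 * (4 * H - 1))) ∧
      -- the stochastic integrals of `B` with respect to `M`
      (∀ A, MeasurableSet A → SelfIntegral.StochIntegralUniquelyDefined 2 P B M A) ∧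
      (∃! N : VectorMeasure unitInterval (Lp ℝ 2 P),
        SelfIntegral.IsRandomMeasure P N ∧
        ∀ A, MeasurableSet A → SelfIntegral.IsStochIntegral 2 P B M A (N A)) := by
  obtain ⟨M₀, hIic⟩ := hB.exists_vectorMeasure_Iic_eq hH
  have hM₀ := hB.isDerivativeRandomMeasure hH hIic
  refine ⟨⟨M₀, hM₀, fun M hM => hM.eq hM₀⟩, fun M hM => ?_⟩
  obtain rfl : M = M₀ := hM.eq hM₀
  have := SelfIntegral.isFiniteMeasure_covMeasure hH
  have hG := hB.isGaussianIntegrator hH hIic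
  have hK := hB.hasContinuousDensity hH hIic
  have hself := hB.isSelfIntegral_crossCovKernel hH hIic
  have hquasi := hB.isQuasiSelfIntegral_crossCovKernel hH hIic
  refine ⟨fun A _ => hB.integral_apply hIic A, fun t => ?_,
    SelfIntegral.integrable_abs_sub_rpow hH,
    ⟨_, (hB.hasGramMeasure hH hIic).isCovarianceMeasure (hB.integral_apply hIic), fun E hE => ?_⟩,
    fun t A hA => ?_, fun t A hA => ?_, hK.isCfmKernel, hK.secondOrderKernel.isCfmKernel,
    hself.selfIntegrable .univ, hself, hquasi.quasiSelfIntegrable .univ .univ, hquasi,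
    fun A hA => hG.stochIntegralUniquelyDefined hA, hG.existsUnique_randomMeasure⟩
  · rw [show Set.Icc 0 t = Set.Iic t from Set.Icc_bot, hIic]
    exact (hB.memLp t).coeFn_toLp
  · rw [Measure.toSignedMeasure_apply_measurable hE, SelfIntegral.covMeasure_real hH hE,
      ← integral_const_mul]
    rfl
  · rw [hK.apply_eq t A hA, ← integral_const_mul]
    rfl
  · rw [hK.apply_eq t A hA]
    exact integral_nonneg fun u => SelfIntegral.crossDensity_nonneg hH _
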